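/- For $c\in\mathbb N=\{0,1,2,\dots\}$, a $c$-labeling $L=(S^1_L,\dots,S^c_L,W_L)$ of a finite simple undirected graph $G=(V,E)$ is a partition of $E$ into $c$ (possibly empty) classes $S_L^i$ of strong edges and a (possibly empty) class $W_L$ of weak edges. It is an STC-labeling if there are no two distinct edges $\{u,v\},\{v,w\}\in S^i_L$ of the same strong class with $\{u,w\}\notin E$. An instance of Multi-STC is a triple $(G,c,k)$ with $c,k\in\mathbb N$; the question is whether $G$ has a $c$-labeling $L$ that is an STC-labeling with $|W_L|\le k$. An instance of EL-Multi-STC is a tuple $(G,c,k,\Psi)$ with, in addition, edge lists $\Psi:E\to 2^{\{1,\dots,c\}}$; the question is whether there is such an $L$ in which, moreover, every edge $e$ is weak or lies in $S_L^i$ for some $i\in\Psi(e)$. Let $\tau=|\Psi(E)\setminus\{\emptyset\}|$ be the number of distinct nonempty edge lists of the instance, and let $k_1=k_1(G)$ be the minimum number of weak edges in an STC-labeling of $G$ with one strong class. A problem kernel for a parameterized problem is a polynomial-time computable map $I\mapsto I'$ on its instances such that $I'$ is a Yes-instance if and only if $I$ is, and such that the sum of the encoding size of $I'$ and the parameter of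 $I'$ is at most a computable function of the parameter of $I$. EL-Multi-STC is parameterized by $c+k_1$ and Multi-STC by $k_1$. Call an instance degenerate if it is a No-instance with $k_1=0$. (Since an instance whose graph has no vertices is always a Yes-instance, a degenerate instance cannot be mapped to an equivalent one with $0$ vertices. For Multi-STC a degenerate instance has $c=0$.) Let $I$ be the given instance and $c$, $\tau$, $k_1$ its values. Then: 1. EL-Multi-STC admits a problem kernel in which the graph of $I'$ has at most $(\tau+1)\cdot 2k_1$ vertices, for every $I$ that is not degenerate, and at most $2$ vertices if $I$ is degenerate. 2. Consequently, EL-Multi-STC admits a problem kernel in which the graph of $I'$ has at most $2^{c+1}k_1$ vertices, for every $I$ that is not degenerate, and at most $2$ vertices if $I$ is degenerate. 3. Multi-STC admits a problem kernel in which the graph of $I'$ has at most $4k_1$ vertices, for every $I$ that is not degenerate, and at most $2$ vertices if $I$ is degenerate; in particular the bound $4k_1$ holds for every $I$ with $c\ge 1$. -/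

import Mathlib

namespace STC

/-! ### Strong triadic closure labelings -/

/-- A `c`-labeling of `G`: a partition of the edge set into `c` (possibly empty) strong colour
classes and a (possibly empty) class of weak edges.  `L e = some i` means that `e` is strong of
colour `i`, and `L e = none` means that `e` is weak. -/
abbrev Labeling {V : Type*} (G : SimpleGraph V) (c : ℕ) : Type _ :=
  G.edgeSet → Option (Fin c)

namespace Labeling

variable {V : Type*} {G : SimpleGraph V} {c : ℕ}

/-- `L` is an STC-labeling: there are no two distinct edges `{u, v}` and `{v, w}` of the same
strong colour such that `{u, w}` is not an edge. -/
def IsSTC (L : Labeling G c) : Prop :=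
  ∀ (u v w : V) (huv : G.Adj u v) (hvw : G.Adj v w) (i : Fin c), u ≠ w →
    L ⟨s(u, v), huv⟩ = some i → L ⟨s(v, w), hvw⟩ = some i → G.Adj u w

/-- The number of weak edges. -/
noncomputable def weakCount (L : Labeling G c) : ℕ :=
  Set.ncard {e : G.edgeSet | L e = none}

/-- `L` is `Ψ`-satisfying: every strong edge has a colour of its list. -/
def Satisfies (L : Labeling G c) (Ψ : G.edgeSet → Finset (Fin c)) : Prop :=
  ∀ e i, L e = some i → i ∈ Ψ e

end Labeling

/-- `k₁(G)`: the minimum number of weak edges in an STC-labeling of `G` with one strong colour.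
The set is nonempty, since the labeling in which every edge is weak is an STC-labeling. -/
noncomputable def k₁ {V : Type*} (G : SimpleGraph V) : ℕ :=
  sInf {m | ∃ L : Labeling G 1, L.IsSTC ∧ L.weakCount = m}

/-! ### The two decision problems

Finite graphs are represented on the vertex sets `{0, …, n - 1}`. -/

/-- An instance `(G, c, k, Ψ)` of EL-Multi-STC. -/
structure ELInstance where
  n : ℕ
  G : SimpleGraph (Fin n)
  c : ℕ
  k : ℕ
  Ψ : G.edgeSet → Finset (Fin c)

/-- An instance `(G, c, k)` of Multi-STC. -/
structure MultiInstance where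
  n : ℕ
  G : SimpleGraph (Fin n)
  c : ℕ
  k : ℕ

/-- The number of distinct nonempty edge lists of the instance. -/
noncomputable def ELInstance.τ (I : ELInstance) : ℕ :=
  Set.ncard (Set.range I.Ψ \ {∅})

/-- The question of EL-Multi-STC. -/
def ELInstance.Yes (I : ELInstance) : Prop :=
  ∃ L : Labeling I.G I.c, L.IsSTC ∧ L.Satisfies I.Ψ ∧ L.weakCount ≤ I.k

/-- The question of Multi-STC. -/
def MultiInstance.Yes (I : MultiInstance) : Prop :=
  ∃ L : Labeling I.G I.c, L.IsSTC ∧ L.weakCount ≤ I.k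

/-! ### A model of computation with a running time

Programs compute on binary trees (S-expressions over the single atom `nil`).  Every elementary
operation is charged at least the size of the tree that it copies, so a run of cost `t` only
produces trees of size at most `t`, and it is simulated by a multitape Turing machine in time
polynomial in the size of the input and `t`.  Conversely a Turing machine (a finite control, and
tapes given as pairs of lists) is simulated step by step with a polynomial overhead.  So the
functions computable in polynomial time below are the usual ones. -/

/-- Binary trees. -/
inductive Data where
  | nil : Data
  | cons : Data → Data → Data

namespace Data

/-- The number of nodes and leaves of a tree. -/
def size : Data → ℕ
  | nil => 1
  | cons a b => a.size + b.size + 1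

/-- The left subtree (`nil` for `nil`). -/
def head : Data → Data
  | nil => nil
  | cons a _ => a

/-- The right subtree (`nil` for `nil`). -/
def tail : Data → Data
  | nil => nil
  | cons _ b => b

/-- Lists as right combs. -/
def ofList : List Data → Data
  | [] => nil
  | a :: l => cons a (ofList l)

/-- Truth values. -/
def ofBool : Bool → Data
  | false => nil
  | true => cons nil nil

/-- Natural numbers in binary, least significant bit first. -/
def ofNat (n : ℕ) : Data :=
  ofList (n.bits.map ofBool)

end Data

/-- Programs; each describes a partial function from trees to trees. -/
inductive Prog where
  /-- return the input -/
  | id : Prog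
  /-- return the tree `nil` -/
  | nil : Prog
  /-- return the left subtree of the input -/
  | head : Prog
  /-- return the right subtree of the input -/
  | tail : Prog
  /-- run both programs on the input and join the two results -/
  | cons : Prog → Prog → Prog
  /-- run both programs on the input and test whether the two results are equal -/
  | eq : Prog → Prog → Prog
  /-- run the first program on the input, then the second one on its result -/
  | seq : Prog → Prog → Prog
  /-- run the second or the third program, as the first one returns a non-`nil` tree or `nil` -/
  | ite : Prog → Prog → Prog → Prog
  /-- while the first program returns a non-`nil` tree, replace the current tree by the result of
  the second program on it -/
  | loop : Prog → Prog → Prog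

/-- `Runs p x y t`: the program `p` halts on the input `x` with the output `y` at cost `t`. -/
inductive Runs : Prog → Data → Data → ℕ → Prop where
  | id (x : Data) : Runs Prog.id x x x.size
  | nil (x : Data) : Runs Prog.nil x Data.nil 1
  | head (x : Data) : Runs Prog.head x x.head x.size
  | tail (x : Data) : Runs Prog.tail x x.tail x.size
  | cons {p q : Prog} {x a b : Data} {s t : ℕ} :
      Runs p x a s → Runs q x b t → Runs (Prog.cons p q) x (Data.cons a b) (s + t + 1)
  | eq_true {p q : Prog} {x a b : Data} {s t : ℕ} :
      Runs p x a s → Runs q x b t → a = b →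
      Runs (Prog.eq p q) x (Data.ofBool true) (s + t + 1)
  | eq_false {p q : Prog} {x a b : Data} {s t : ℕ} :
      Runs p x a s → Runs q x b t → a ≠ b →
      Runs (Prog.eq p q) x (Data.ofBool false) (s + t + 1)
  | seq {p q : Prog} {x y z : Data} {s t : ℕ} :
      Runs p x y s → Runs q y z t → Runs (Prog.seq p q) x z (s + t + 1)
  | ite_true {p q r : Prog} {x a b y : Data} {s t : ℕ} :
      Runs p x (Data.cons a b) s → Runs q x y t → Runs (Prog.ite p q r) x y (s + t + 1)
  | ite_false {p q r : Prog} {x y : Data} {s t : ℕ} :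
      Runs p x Data.nil s → Runs r x y t → Runs (Prog.ite p q r) x y (s + t + 1)
  | loop_stop {p q : Prog} {x : Data} {s : ℕ} :
      Runs p x Data.nil s → Runs (Prog.loop p q) x x (s + x.size + 1)
  | loop_step {p q : Prog} {x a b y z : Data} {s t r : ℕ} :
      Runs p x (Data.cons a b) s → Runs q x y t → Runs (Prog.loop p q) y z r →
      Runs (Prog.loop p q) x z (s + t + r + 1)

/-- `f` is computable in time polynomial in the size of the encoded input. -/
def PolyTimeComputable {α β : Type} (encα : α → Data) (encβ : β → Data) (f : α → β) : Prop :=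
  ∃ (p : Prog) (T : Polynomial ℕ), ∀ x : α, ∃ t : ℕ,
    t ≤ T.eval (encα x).size ∧ Runs p (encα x) (encβ (f x)) t

/-! ### Encodings of instances

Numbers are written in binary, a graph as its adjacency matrix; in an instance of EL-Multi-STC an
entry of the matrix that belongs to an edge also holds the sorted list of the colours that are
allowed for this edge. -/

/-- A matrix, as the list of its rows. -/
def encodeMatrix {n : ℕ} (A : Fin n → Fin n → Data) : Data :=
  Data.ofList (List.ofFn fun i => Data.ofList (List.ofFn fun j => A i j))

/-- A finite set of colours, as the increasing list of its elements. -/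
def encodeColors {c : ℕ} (s : Finset (Fin c)) : Data :=
  Data.ofList ((s.sort (· ≤ ·)).map fun i : Fin c => Data.ofNat i.val)

open Classical in
/-- The encoding of an instance of EL-Multi-STC. -/
noncomputable def ELInstance.encode (I : ELInstance) : Data :=
  Data.cons (Data.ofNat I.c) (Data.cons (Data.ofNat I.k)
    (encodeMatrix fun i j =>
      if h : I.G.Adj i j then Data.cons Data.nil (encodeColors (I.Ψ ⟨s(i, j), h⟩))
      else Data.nil))

open Classical in
/-- The encoding of an instance of Multi-STC. -/
noncomputable def MultiInstance.encode (I : MultiInstance) : Data :=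
  Data.cons (Data.ofNat I.c) (Data.cons (Data.ofNat I.k)
    (encodeMatrix fun i j => Data.ofBool (decide (I.G.Adj i j))))

/-! ### Parameterized problems and problem kernels -/

/-- A parameterized problem: its instances with their encoding, the set of Yes-instances, and the
parameter. -/
structure ParamProblem where
  Inst : Type
  encode : Inst → Data
  Yes : Inst → Prop
  param : Inst → ℕ

/-- A kernelization: a polynomial-time computable map that sends each instance to an equivalent
instance whose size and parameter are bounded by a computable function of the parameter of the
given instance. -/
def IsKernelization (P : ParamProblem) (f : P.Inst → P.Inst) : Prop :=
  PolyTimeComputable P.encode P.encode f ∧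
  (∀ I, P.Yes (f I) ↔ P.Yes I) ∧
  ∃ g : ℕ → ℕ, Computable g ∧ ∀ I, (P.encode (f I)).size + P.param (f I) ≤ g (P.param I)

/-- EL-Multi-STC parameterized by `(c, k₁)`. -/
noncomputable def ELMultiSTC : ParamProblem where
  Inst := ELInstance
  encode := ELInstance.encode
  Yes := ELInstance.Yes
  param I := I.c + k₁ I.G

/-- Multi-STC parameterized by `k₁`. -/
noncomputable def MultiSTC : ParamProblem where
  Inst := MultiInstance
  encode := MultiInstance.encode
  Yes := MultiInstance.Yes
  param I := k₁ I.G

end STC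

/-! The kernel is an induced subgraph, found by deleting redundant vertices. Call `v` redundant if
its neighbourhood is a clique and, for every neighbour `u` with a nonempty list on `vu`, the edges
`uw` with `w` outside `N[v]` (`conflicts`) are at most as many as the common neighbours `x` of `u`
and `v` with `N(x) ⊆ N[v]` and the same list on `xu` (`twins`).

Deletion is safe when the budget drops by the number of empty lists at `v` (`yesOn_erase_iff`). To
colour `vu` in a labeling of the rest, distinguish two cases. If some twin edge `xu` is strong, its
colour also works for `vu`, since a conflict edge of that colour would be in conflict with `xu`.
Otherwise all twin edges at `u` are weak: give all of them one colour of the list and make all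
conflict edges weak. The number of weak edges does not grow, and the colour is free for `vu`. The
repairs at different `u` do not interfere, because edges only become strong inside the clique `N(v)`
(`exists_recoloring`, `exists_extension`).

For the size (`card_retained_le`), fix an optimal labeling with one strong class and let `H` be the
graph of its weak edges, with degree sum `2k₁`. At most `2k₁` vertices have an `H`-edge. Any other
vertex has only strong edges, so its neighbourhood is a clique, and if it is retained, the test
failed at some `u` with a nonempty list. Retained vertices with the same `u` and the same list are
twins of each other, so their number is at most that of the conflicts at `u`, all of which are
`H`-edges. Summing over `u` and the `τ` lists gives another `τ · 2k₁`. One sweep suffices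
(`sweep_spec`), as later deletions do not affect this count.

It remains to run the sweep on encodings in polynomial time. Everything is composed from `PT.foldl`,
and `Represents` links matrix entries to edges and lists. An exhausted budget yields a fixed
No-instance on two vertices, which accounts for the degenerate case. -/

namespace STC

open Polynomial

/-! ### Trees as lists, and their sizes -/

namespace Data

/-- The elements of a right comb. -/
def toList : Data → List Data
  | nil => []
  | cons a b => a :: b.toList

@[simp] theorem toList_nil : toList nil = [] := rfl
@[simp] theorem toList_cons (a b : Data) : toList (cons a b) = a :: b.toList := rfl
@[simp] theorem ofList_nil : ofList [] = nil := rfl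
@[simp] theorem ofList_cons (a : Data) (l : List Data) :
    ofList (a :: l) = cons a (ofList l) := rfl

@[simp] theorem ofList_toList : ∀ d : Data, ofList d.toList = d
  | nil => rfl
  | cons a b => by simp [ofList_toList b]

@[simp] theorem toList_ofList (l : List Data) : (ofList l).toList = l := by
  induction l with
  | nil => rfl
  | cons a l ih => simp [ih]

theorem ofList_injective : Function.Injective ofList :=
  Function.LeftInverse.injective toList_ofList

theorem foldl_cons_eq (l : List Data) (a : Data) :
    l.foldl (fun acc e => cons e acc) a = ofList (l.reverse ++ a.toList) := by
  induction l generalizing a with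
  | nil => simp
  | cons b l ih => simp [ih]

theorem size_pos : ∀ d : Data, 1 ≤ d.size
  | nil => le_rfl
  | cons a b => by simp [size]

@[simp] theorem size_nil : size nil = 1 := rfl
@[simp] theorem size_cons (a b : Data) : (cons a b).size = a.size + b.size + 1 := rfl
@[simp] theorem head_nil : nil.head = nil := rfl
@[simp] theorem tail_nil : nil.tail = nil := rfl
@[simp] theorem head_cons (a b : Data) : (cons a b).head = a := rfl
@[simp] theorem tail_cons (a b : Data) : (cons a b).tail = b := rfl

theorem size_head_le : ∀ d : Data, d.head.size ≤ d.size
  | nil => le_rfl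
  | cons a b => by simp only [head_cons, size_cons]; omega

theorem size_tail_le : ∀ d : Data, d.tail.size ≤ d.size
  | nil => le_rfl
  | cons a b => by simp only [tail_cons, size_cons]; omega

theorem length_toList_le : ∀ d : Data, d.toList.length ≤ d.size
  | nil => by simp
  | cons a b => by
    have := length_toList_le b
    simp only [toList_cons, List.length_cons, size_cons]; omega

theorem size_le_of_mem_toList : ∀ {d e : Data}, e ∈ d.toList → e.size ≤ d.size
  | nil, e, h => by simp at h
  | cons a b, e, h => by
    rw [toList_cons, List.mem_cons] at h
    simp only [size_cons]
    rcases h with rfl | h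
    · omega
    · have := size_le_of_mem_toList h; omega

theorem size_ofList (l : List Data) : (ofList l).size = (l.map fun d => d.size + 1).sum + 1 := by
  induction l with
  | nil => rfl
  | cons a l ih => simp [ih]; omega

end Data

/-- Every operation is charged for what it copies. Hence a time bound is also an output bound, which
controls the second program in a composition. -/
theorem Runs.size_le {p : Prog} {x y : Data} {t : ℕ} (h : Runs p x y t) : y.size ≤ t := by
  induction h with
  | id x => exact le_rfl
  | nil x => exact le_rfl
  | head x => exact x.size_head_le
  | tail x => exact x.size_tail_le
  | cons _ _ ih₁ ih₂ => simp only [Data.size_cons]; omega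
  | @eq_true _ _ _ a b _ _ _ _ _ ih₁ ih₂ =>
    have := a.size_pos; have := b.size_pos
    simp only [Data.ofBool, Data.size_cons, Data.size_nil]; omega
  | eq_false _ _ _ ih₁ ih₂ => simp only [Data.ofBool, Data.size_nil]; omega
  | _ => omega

/-! ### Closure properties of polynomial-time functions -/

theorem eval_mono (T : ℕ[X]) {a b : ℕ} (h : a ≤ b) : T.eval a ≤ T.eval b := by
  rw [eval_eq_sum_range, eval_eq_sum_range]
  gcongr

/-- `F` is computable in time polynomial in the size of its argument. -/
def PT (F : Data → Data) : Prop :=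
  ∃ (p : Prog) (T : ℕ[X]), ∀ x : Data, ∃ t : ℕ, t ≤ T.eval x.size ∧ Runs p x (F x) t

/-- The predicate `P` is decidable in polynomial time. -/
def PTP (P : Data → Prop) : Prop :=
  ∃ b : Data → Data, PT b ∧ ∀ x, b x ≠ Data.nil ↔ P x

namespace PT

theorem polyTimeComputable {α β : Type} {encα : α → Data} {encβ : β → Data} {f : α → β}
    {F : Data → Data} (hF : PT F) (h : ∀ x, F (encα x) = encβ (f x)) :
    PolyTimeComputable encα encβ f := by
  obtain ⟨p, T, hp⟩ := hF
  exact ⟨p, T, fun x => by simpa only [h] using hp (encα x)⟩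

theorem size_bound {F : Data → Data} (hF : PT F) :
    ∃ T : ℕ[X], ∀ x, (F x).size ≤ T.eval x.size := by
  obtain ⟨p, T, hp⟩ := hF
  refine ⟨T, fun x => ?_⟩
  obtain ⟨t, ht, hr⟩ := hp x
  exact hr.size_le.trans ht

theorem id : PT fun x => x :=
  ⟨Prog.id, X, fun x => ⟨_, by simp, Runs.id x⟩⟩

theorem nil : PT fun _ => Data.nil :=
  ⟨Prog.nil, 1, fun x => ⟨_, by simp, Runs.nil x⟩⟩

theorem comp {f g : Data → Data} (hg : PT g) (hf : PT f) : PT fun x => g (f x) := by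
  obtain ⟨p, T, hp⟩ := hf
  obtain ⟨q, U, hq⟩ := hg
  refine ⟨Prog.seq p q, T + U.comp T + 1, fun x => ?_⟩
  obtain ⟨s, hs, hr⟩ := hp x
  obtain ⟨t, ht, hr'⟩ := hq (f x)
  refine ⟨_, ?_, Runs.seq hr hr'⟩
  have := ht.trans (eval_mono U (hr.size_le.trans hs))
  simp only [eval_add, eval_comp, eval_one]
  omega

theorem head {f : Data → Data} (hf : PT f) : PT fun x => (f x).head :=
  comp (g := Data.head) ⟨Prog.head, X, fun x => ⟨_, by simp, Runs.head x⟩⟩ hf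

theorem tail {f : Data → Data} (hf : PT f) : PT fun x => (f x).tail :=
  comp (g := Data.tail) ⟨Prog.tail, X, fun x => ⟨_, by simp, Runs.tail x⟩⟩ hf

theorem cons {f g : Data → Data} (hf : PT f) (hg : PT g) : PT fun x => Data.cons (f x) (g x) := by
  obtain ⟨p, T, hp⟩ := hf
  obtain ⟨q, U, hq⟩ := hg
  refine ⟨Prog.cons p q, T + U + 1, fun x => ?_⟩
  obtain ⟨s, hs, hr⟩ := hp x
  obtain ⟨t, ht, hr'⟩ := hq x
  refine ⟨_, ?_, Runs.cons hr hr'⟩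
  simp only [eval_add, eval_one]
  omega

theorem const : ∀ d : Data, PT fun _ => d
  | Data.nil => nil
  | Data.cons a b => (const a).cons (const b)

/-- A function of two arguments, applied to polynomial time computable arguments. -/
theorem comp₂ {g : Data → Data → Data} (hg : PT fun y => g y.head y.tail) {a b : Data → Data}
    (ha : PT a) (hb : PT b) : PT fun x => g (a x) (b x) :=
  hg.comp (ha.cons hb)

theorem ite {P : Data → Prop} [DecidablePred P] (hP : PTP P) {f g : Data → Data} (hf : PT f)
    (hg : PT g) : PT fun x => if P x then f x else g x := by
  obtain ⟨b, ⟨r, S, hr⟩, hb⟩ := hP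
  obtain ⟨p, T, hp⟩ := hf
  obtain ⟨q, U, hq⟩ := hg
  refine ⟨Prog.ite r p q, S + T + U + 1, fun x => ?_⟩
  obtain ⟨s, hs, hrs⟩ := hr x
  obtain ⟨t, ht, hrt⟩ := hp x
  obtain ⟨u, hu, hru⟩ := hq x
  simp only [eval_add, eval_one]
  by_cases h : P x
  · rw [if_pos h]
    have h' := (hb x).2 h
    cases hbx : b x with
    | nil => exact absurd hbx h'
    | cons c d =>
      rw [hbx] at hrs
      exact ⟨_, by omega, Runs.ite_true hrs hrt⟩
  · rw [if_neg h]
    have h' : b x = Data.nil := by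
      by_contra h'
      exact h ((hb x).1 h')
    rw [h'] at hrs
    exact ⟨_, by omega, Runs.ite_false hrs hru⟩

/-- Left folds whose accumulator grows by a polynomial amount in each step. -/
theorem foldl {step : Data → Data → Data → Data} {init lst : Data → Data}
    (hs : PT fun y => step y.head y.tail.head y.tail.tail) (hi : PT init) (hl : PT lst)
    (B : ℕ[X])
    (hB : ∀ acc e x, (step acc e x).size ≤ acc.size + B.eval (e.size + x.size)) :
    PT fun x => (lst x).toList.foldl (fun acc e => step acc e x) (init x) := by
  -- The loop state is `cons acc (cons rest x)`: the accumulator, the unread part of the list, and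
  -- the original input.
  have hbody : PT fun y => Data.cons (step y.head y.tail.head.head y.tail.tail)
      (Data.cons y.tail.head.tail y.tail.tail) :=
    (hs.comp (f := fun y => Data.cons y.head (Data.cons y.tail.head.head y.tail.tail))
      (id.head.cons (id.tail.head.head.cons id.tail.tail))).cons
      (id.tail.head.tail.cons id.tail.tail)
  have hcond : PT fun y => y.tail.head := id.tail.head
  have hstart : PT fun x => Data.cons (init x) (Data.cons (lst x) x) := hi.cons (hl.cons id)
  obtain ⟨Si, hSi⟩ := hi.size_bound
  obtain ⟨Sl, hSl⟩ := hl.size_bound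
  obtain ⟨q, U, hq⟩ := hbody
  obtain ⟨r, R, hr⟩ := hcond
  -- the cost of the loop, while the size of the state is bounded by `N`
  have loop : ∀ (x : Data) (M N : ℕ) (l acc : Data), (∀ e ∈ l.toList, e.size ≤ M) →
      acc.size + l.toList.length * B.eval (M + x.size) + l.size + x.size + 2 ≤ N →
      ∃ t, t ≤ (l.toList.length + 1) * (R.eval N + U.eval N + N + 1) ∧
        Runs (Prog.loop r q) (Data.cons acc (Data.cons l x))
          (Data.cons (l.toList.foldl (fun acc e => step acc e x) acc)
            (Data.cons Data.nil x)) t := by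
    intro x M N l
    induction l with
    | nil =>
      intro acc _ hN
      obtain ⟨s, hs', hrs⟩ := hr (Data.cons acc (Data.cons Data.nil x))
      have hN' : (Data.cons acc (Data.cons Data.nil x)).size ≤ N := by
        simp at hN ⊢; omega
      have := eval_mono R hN'
      refine ⟨_, ?_, Runs.loop_stop hrs⟩
      simp only [Data.toList_nil, List.length_nil]
      omega
    | cons e l _ ih =>
      intro acc hM hN
      obtain ⟨s, hs', hrs⟩ := hr (Data.cons acc (Data.cons (Data.cons e l) x))
      obtain ⟨t, ht', hrt⟩ := hq (Data.cons acc (Data.cons (Data.cons e l) x))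
      have he : e.size ≤ M := hM e (by simp)
      have hst := (hB acc e x).trans (Nat.add_le_add_left
        (eval_mono B (Nat.add_le_add_right he x.size)) acc.size)
      have hN' : (Data.cons acc (Data.cons (Data.cons e l) x)).size ≤ N := by
        simp at hN ⊢; omega
      have h₁ := eval_mono R hN'
      have h₂ := eval_mono U hN'
      obtain ⟨u, hu, hru⟩ := ih (step acc e x) (fun e' he' => hM e' (by simp [he'])) (by
        simp only [Data.toList_cons, List.length_cons, Data.size_cons] at hN
        rw [Nat.succ_mul] at hN
        omega)
      refine ⟨_, ?_, Runs.loop_step hrs hrt hru⟩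
      simp only [Data.toList_cons, List.length_cons]
      rw [Nat.succ_mul]
      omega
  have hloop : ∃ N : ℕ[X], ∀ x, ∃ t, t ≤ N.eval x.size ∧
      Runs (Prog.loop r q) (Data.cons (init x) (Data.cons (lst x) x))
        (Data.cons ((lst x).toList.foldl (fun acc e => step acc e x) (init x))
          (Data.cons Data.nil x)) t := by
    -- `Sl` bounds both the number of list elements and the size of each, so the total growth of the
    -- accumulator is at most `Sl * B(Sl + X)`. Additive growth per step is what keeps the states
    -- polynomial.
    obtain ⟨P, hP⟩ : ∃ P : ℕ[X], ∀ x, (init x).size + (lst x).toList.length *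
        B.eval (Sl.eval x.size + x.size) + (lst x).size + x.size + 2 ≤ P.eval x.size := by
      refine ⟨Si + Sl * B.comp (Sl + X) + Sl + X + 2, fun x => ?_⟩
      simp only [eval_add, eval_mul, eval_comp, eval_X, eval_ofNat]
      have := Nat.mul_le_mul_right (B.eval (Sl.eval x.size + x.size))
        ((lst x).length_toList_le.trans (hSl x))
      have := hSi x
      have := hSl x
      omega
    refine ⟨(Sl + 1) * (R.comp P + U.comp P + P + 1), fun x => ?_⟩
    obtain ⟨t, ht, hrt⟩ := loop x (Sl.eval x.size) (P.eval x.size) (lst x) (init x)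
      (fun e he => (Data.size_le_of_mem_toList he).trans (hSl x)) (hP x)
    refine ⟨t, ht.trans ?_, hrt⟩
    have hlen := (lst x).length_toList_le.trans (hSl x)
    simp only [eval_add, eval_mul, eval_comp, eval_one]
    exact Nat.mul_le_mul_right _ (by omega)
  obtain ⟨p₀, T₀, hp₀⟩ := hstart
  obtain ⟨N, hN⟩ := hloop
  refine head (f := fun x => Data.cons ((lst x).toList.foldl (fun acc e => step acc e x) (init x))
    (Data.cons Data.nil x)) ⟨Prog.seq p₀ (Prog.loop r q), T₀ + N + 1, fun x => ?_⟩
  obtain ⟨s, hs', hrs⟩ := hp₀ x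
  obtain ⟨t, ht, hrt⟩ := hN x
  refine ⟨_, ?_, Runs.seq hrs hrt⟩
  simp only [eval_add, eval_one]
  omega

/-- Folds build their output back to front, so this turns the results of the folds below into the
right order. -/
theorem reverse {f : Data → Data} (hf : PT f) :
    PT fun x => Data.ofList (f x).toList.reverse := by
  have h := foldl (step := fun acc e _ => Data.cons e acc) (id.tail.head.cons id.head) nil hf
    (X + 1) (fun acc e x => by simp; omega)
  convert h using 2 with x
  rw [Data.foldl_cons_eq]
  simp

theorem append {f g : Data → Data} (hf : PT f) (hg : PT g) :
    PT fun x => Data.ofList ((f x).toList ++ (g x).toList) := by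
  have h := foldl (step := fun acc e _ => Data.cons e acc) (id.tail.head.cons id.head) hg
    hf.reverse (X + 1) (fun acc e x => by simp; omega)
  convert h using 2 with x
  rw [Data.foldl_cons_eq]
  simp

theorem map {g : Data → Data → Data} (hg : PT fun y => g y.head y.tail) {lst : Data → Data}
    (hl : PT lst) : PT fun x => Data.ofList ((lst x).toList.map fun e => g e x) := by
  obtain ⟨T, hT⟩ := hg.size_bound
  have h := (foldl (step := fun acc e x => Data.cons (g e x) acc)
    ((hg.comp₂ (g := fun a b => g a b) id.tail.head id.tail.tail).cons id.head) nil hl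
    (T.comp (X + 1) + 1) (fun acc e x => by
      have := hT (Data.cons e x)
      simp [eval_comp] at this ⊢
      omega)).reverse
  convert h using 2 with x
  have : ∀ (l : List Data) (a : Data),
      (l.foldl (fun acc e => Data.cons (g e x) acc) a).toList
        = (l.map fun e => g e x).reverse ++ a.toList := by
    intro l
    induction l with
    | nil => simp
    | cons b l ih => intro a; simp [ih]
  simp [this]

theorem filter {P : Data → Data → Prop} [∀ x, DecidablePred fun e => P e x]
    (hP : PTP fun y => P y.head y.tail) {lst : Data → Data} (hl : PT lst) :
    PT fun x => Data.ofList ((lst x).toList.filter fun e => P e x) := by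
  classical
  obtain ⟨b, hb, hb'⟩ := hP
  have hP' : PTP fun y : Data => P y.tail.head y.tail.tail :=
    ⟨_, hb.comp (id.tail.head.cons id.tail.tail), fun x => by rw [hb']; rfl⟩
  have h := (foldl (step := fun acc e x => if P e x then Data.cons e acc else acc)
    (ite hP' (id.tail.head.cons id.head) id.head) nil hl (X + 1) (fun acc e x => by
      split_ifs <;> simp; omega)).reverse
  convert h using 2 with x
  have : ∀ (l : List Data) (a : Data),
      (l.foldl (fun acc e => if P e x then Data.cons e acc else acc) a).toList
        = (l.filter fun e => P e x).reverse ++ a.toList := by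
    intro l
    induction l with
    | nil => simp
    | cons b l ih => intro a; by_cases hb : P b x <;> simp [ih, hb]
  simp [this]

theorem zip {f g : Data → Data} (hf : PT f) (hg : PT g) :
    PT fun x => Data.ofList (List.zipWith Data.cons (f x).toList (g x).toList) := by
  classical
  -- The accumulator holds the unread part of the second list and the reversed output. It stays
  -- fixed once the second list is exhausted, which matches the truncation of `List.zipWith`.
  have hstep : PT fun y => if y.head.head = Data.nil then y.head else
      Data.cons y.head.head.tail (Data.cons (Data.cons y.tail.head y.head.head.head) y.head.tail) :=
    ite ⟨_, ite ⟨fun x => x.head.head, id.head.head, fun x => Iff.rfl⟩ nil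
      (const (Data.cons Data.nil Data.nil)), fun x => by split_ifs with h <;> simpa using h⟩ id.head
      (id.head.head.tail.cons ((id.tail.head.cons id.head.head.head).cons id.head.tail))
  have h := (foldl (step := fun acc e _ => if acc.head = Data.nil then acc else
      Data.cons acc.head.tail (Data.cons (Data.cons e acc.head.head) acc.tail))
    (init := fun x => Data.cons (g x) Data.nil) hstep (hg.cons nil) hf (X + 4) (fun acc e x => by
      split_ifs with h
      · simp
      · rcases acc with _ | ⟨_ | ⟨a, b⟩, c⟩ <;> simp at h ⊢; omega)).tail.reverse
  convert h using 2 with x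
  have : ∀ (l : List Data) (a b : Data),
      (l.foldl (fun acc e => if acc.head = Data.nil then acc else
        Data.cons acc.head.tail (Data.cons (Data.cons e acc.head.head) acc.tail))
        (Data.cons a b)).tail.toList
        = (List.zipWith Data.cons l a.toList).reverse ++ b.toList := by
    intro l
    induction l with
    | nil => simp
    | cons d l ih =>
      intro a b
      cases a with
      | nil =>
        have := ih Data.nil b
        simpa using this
      | cons a a' =>
        simp [ih]
  simp [this]

/-- For lists used as unary numbers this is truncated subtraction. It serves both to update the
budget and to compare cardinalities. -/
theorem drop {f g : Data → Data} (hf : PT f) (hg : PT g) :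
    PT fun x => Data.ofList ((f x).toList.drop (g x).toList.length) := by
  have h := foldl (step := fun acc _ _ => acc.tail) id.head.tail hf hg 0
    (fun acc e x => by simpa using acc.size_tail_le)
  convert h using 2 with x
  have : ∀ (l : List Data) (a : Data),
      l.foldl (fun acc _ => acc.tail) a = Data.ofList (a.toList.drop l.length) := by
    intro l
    induction l with
    | nil => simp
    | cons b l ih => intro a; rw [List.foldl_cons, ih]; cases a <;> simp
  rw [this]

end PT

/-! ### Closure properties of polynomial-time predicates -/

namespace PTP

theorem of_iff {P Q : Data → Prop} (hP : PTP P) (h : ∀ x, Q x ↔ P x) : PTP Q := by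
  obtain ⟨b, hb, hb'⟩ := hP
  exact ⟨b, hb, fun x => (hb' x).trans (h x).symm⟩

theorem comp {P : Data → Prop} (hP : PTP P) {f : Data → Data} (hf : PT f) :
    PTP fun x => P (f x) := by
  obtain ⟨b, hb, hb'⟩ := hP
  exact ⟨_, hb.comp hf, fun x => hb' (f x)⟩

theorem ne_nil {f : Data → Data} (hf : PT f) : PTP fun x => f x ≠ Data.nil :=
  ⟨f, hf, fun _ => Iff.rfl⟩

theorem not {P : Data → Prop} (hP : PTP P) : PTP fun x => ¬ P x := by
  classical
  refine ⟨_, PT.ite hP PT.nil (PT.const (Data.cons Data.nil Data.nil)), fun x => ?_⟩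
  by_cases h : P x <;> simp [h]

theorem and {P Q : Data → Prop} (hP : PTP P) (hQ : PTP Q) : PTP fun x => P x ∧ Q x := by
  classical
  obtain ⟨b, hb, hb'⟩ := hQ
  refine ⟨_, PT.ite hP hb PT.nil, fun x => ?_⟩
  by_cases h : P x <;> simp [h, ← hb']

theorem or {P Q : Data → Prop} (hP : PTP P) (hQ : PTP Q) : PTP fun x => P x ∨ Q x :=
  (hP.not.and hQ.not).not.of_iff fun x => by tauto

theorem imp {P Q : Data → Prop} (hP : PTP P) (hQ : PTP Q) : PTP fun x => P x → Q x :=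
  (hP.and hQ.not).not.of_iff fun x => by tauto

theorem eq {f g : Data → Data} (hf : PT f) (hg : PT g) : PTP fun x => f x = g x := by
  classical
  refine ⟨fun x => Data.ofBool (decide (f x = g x)), ?_, fun x => ?_⟩
  · obtain ⟨p, T, hp⟩ := hf
    obtain ⟨q, U, hq⟩ := hg
    refine ⟨Prog.eq p q, T + U + 1, fun x => ?_⟩
    obtain ⟨s, hs, hr⟩ := hp x
    obtain ⟨t, ht, hr'⟩ := hq x
    refine ⟨s + t + 1, ?_, ?_⟩
    · simp only [Polynomial.eval_add, Polynomial.eval_one]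
      omega
    · by_cases h : f x = g x
      · simpa only [h, decide_true] using Runs.eq_true hr hr' h
      · simpa only [h, decide_false] using Runs.eq_false hr hr' h
  · by_cases h : f x = g x <;> simp [h, Data.ofBool]

theorem forall_mem {P : Data → Data → Prop} (hP : PTP fun y => P y.head y.tail)
    {lst : Data → Data} (hl : PT lst) : PTP fun x => ∀ e ∈ (lst x).toList, P e x := by
  classical
  refine (eq (PT.filter (P := fun e x => ¬ P e x) hP.not hl) PT.nil).of_iff fun x => ?_
  rw [← Data.ofList_nil, Data.ofList_injective.eq_iff, List.filter_eq_nil_iff]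
  simp

theorem length_le {f g : Data → Data} (hf : PT f) (hg : PT g) :
    PTP fun x => (f x).toList.length ≤ (g x).toList.length := by
  refine (eq (PT.drop hf hg) PT.nil).of_iff fun x => ?_
  rw [← Data.ofList_nil, Data.ofList_injective.eq_iff, List.drop_eq_nil_iff]

end PTP

/-! ### Binary and unary numbers, and operations on matrices -/

namespace Data

/-- Addition of one to a list of bits, least significant bit first. -/
def inc : Data → Data
  | nil => cons (cons nil nil) nil
  | cons nil l => cons (cons nil nil) l
  | cons (cons _ _) l => cons nil l.inc

theorem size_inc_le : ∀ d : Data, d.inc.size ≤ d.size + 4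
  | nil => by simp [inc]
  | cons nil l => by simp [inc]; omega
  | cons (cons _ _) l => by
    have := size_inc_le l
    simp [inc]; omega

theorem inc_ofNat (n : ℕ) : (ofNat n).inc = ofNat (n + 1) := by
  induction n using Nat.binaryRec' with
  | zero => simp [ofNat, inc, ofBool]
  | bit b n h ih =>
    cases b with
    | false =>
      have h1 : Nat.bit false n + 1 = Nat.bit true n := by simp [Nat.bit]
      rw [h1, ofNat, ofNat, Nat.bits_append_bit _ _ h, Nat.bits_append_bit _ _ (by simp)]
      simp [ofBool, inc]
    | true =>
      have h1 : Nat.bit true n + 1 = Nat.bit false (n + 1) := by simp [Nat.bit]; ring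
      rw [h1, ofNat, ofNat, Nat.bits_append_bit _ _ h, Nat.bits_append_bit _ _ (by simp)]
      simp only [ofBool, inc, List.map_cons, ofList_cons]
      rw [← ofNat, ih, ofNat]

theorem ofBool_injective : Function.Injective ofBool := by
  intro a b h
  cases a <;> cases b <;> simp [ofBool] at h ⊢

theorem ofNat_injective : Function.Injective ofNat := by
  intro a b h
  have h' := (List.map_injective_iff.2 ofBool_injective) (ofList_injective h)
  have : ∀ n : ℕ, n.bits.foldr (fun b m => Nat.bit b m) 0 = n := by
    intro n
    induction n using Nat.binaryRec' with
    | zero => simp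
    | bit b n h ih => rw [Nat.bits_append_bit _ _ h, List.foldr_cons, ih]
  rw [← this a, h', this b]

/-- Natural numbers in unary. -/
def unary (n : ℕ) : Data := ofList (List.replicate n nil)

@[simp] theorem toList_unary (n : ℕ) : (unary n).toList = List.replicate n nil := by simp [unary]

/-- The length of a list, in binary. -/
def lengthBin (d : Data) : Data := d.toList.foldl (fun acc _ => acc.inc) (ofNat 0)

theorem lengthBin_eq (d : Data) : d.lengthBin = ofNat d.toList.length := by
  have : ∀ (l : List Data) (j : ℕ),
      l.foldl (fun acc _ => acc.inc) (ofNat j) = ofNat (j + l.length) := by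
    intro l
    induction l with
    | nil => simp
    | cons a l ih =>
      intro j
      rw [List.foldl_cons, inc_ofNat, ih, List.length_cons]
      congr 1
      omega
  rw [lengthBin, this, zero_add]

open Classical in
/-- The minimum, in unary, of a number in binary and the length of a list. -/
noncomputable def capUnary (k l : Data) : Data :=
  (l.toList.foldl (fun acc _ => if acc.head = k then acc else
    cons acc.head.inc (cons nil acc.tail)) (cons (ofNat 0) nil)).tail

/-- A number in binary can be exponentially larger than its encoding, so it is written in unary only
up to the length of `l`. A binary counter advances along `l` and stops on reaching `k`; comparing
trees is sound by `ofNat_injective`. -/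
theorem capUnary_ofNat (k : ℕ) (l : Data) :
    capUnary (ofNat k) l = unary (min k l.toList.length) := by
  classical
  have : ∀ (m : List Data) (j : ℕ), j ≤ k →
      m.foldl (fun acc _ => if acc.head = ofNat k then acc else
        cons acc.head.inc (cons nil acc.tail)) (cons (ofNat j) (unary j))
        = cons (ofNat (min k (j + m.length))) (unary (min k (j + m.length))) := by
    intro m
    induction m with
    | nil => intro j hj; simp [hj]
    | cons a m ih =>
      intro j hj
      rw [List.foldl_cons, head_cons]
      by_cases h : j = k
      · subst h
        rw [if_pos rfl, ih j le_rfl]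
        simp
      · rw [if_neg fun h' => h (ofNat_injective h'), inc_ofNat, tail_cons]
        have : cons nil (unary j) = unary (j + 1) := by
          simp [unary, List.replicate_succ]
        rw [this, ih _ (by omega), List.length_cons, Nat.add_right_comm, Nat.add_assoc]
  rw [capUnary]
  have h := this l.toList 0 (Nat.zero_le _)
  rw [show unary 0 = nil from rfl] at h
  rw [h, tail_cons, zero_add]

/-- Cyclic rotation of a list by one place. -/
def rot : Data → Data
  | nil => nil
  | cons a l => ofList (l.toList ++ [a])

theorem size_rot : ∀ d : Data, d.rot.size = d.size
  | nil => rfl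
  | cons a l => by
    conv_rhs => rw [← ofList_toList l]
    simp only [rot, size_ofList, size_cons, List.map_append, List.map_cons, List.map_nil,
      List.sum_append, List.sum_cons, List.sum_nil]
    omega

/-- Simultaneous cyclic rotation of the rows and the columns of a matrix. -/
def rotMatrix (d : Data) : Data := rot (ofList (d.toList.map rot))

/-- Deletion of the first row and the first column of a matrix. -/
def delMatrix (d : Data) : Data := ofList (d.tail.toList.map tail)

theorem size_rotMatrix (d : Data) : d.rotMatrix.size = d.size := by
  rw [rotMatrix, size_rot]
  conv_rhs => rw [← ofList_toList d]
  simp only [size_ofList, List.map_map, Function.comp_def, size_rot]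

theorem size_delMatrix_le (d : Data) : d.delMatrix.size ≤ d.size := by
  refine le_trans ?_ d.size_tail_le
  conv_rhs => rw [← ofList_toList d.tail]
  rw [delMatrix, size_ofList, size_ofList]
  refine Nat.add_le_add_right ?_ 1
  rw [List.map_map]
  refine List.sum_le_sum fun e _ => ?_
  exact Nat.add_le_add_right e.size_tail_le 1

/-- The concatenation of the rows of a matrix, in any order. -/
def flat (d : Data) : Data := d.toList.foldl (fun acc e => ofList (e.toList ++ acc.toList)) nil

/-- Only this length is ever used: for an `n × n` matrix it provides the cap `n ^ 2`. -/
theorem length_flat (d : Data) :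
    d.flat.toList.length = (d.toList.map fun e => e.toList.length).sum := by
  have : ∀ (l : List Data) (a : Data),
      (l.foldl (fun acc e => ofList (e.toList ++ acc.toList)) a).toList.length
        = (l.map fun e => e.toList.length).sum + a.toList.length := by
    intro l
    induction l with
    | nil => simp
    | cons b l ih => intro a; simp [ih]; omega
  rw [flat, this]
  simp

end Data

/-! ### Running times of these operations -/

namespace PT

theorem inc {f : Data → Data} (hf : PT f) : PT fun x => (f x).inc := by
  classical
  -- The head of the accumulator is non-`nil` exactly while a carry is pending; its tail collects
  -- the output bits in reverse.
  have hstep : PT fun y : Data => if y.head.head = Data.nil then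
      Data.cons Data.nil (Data.cons y.tail.head y.head.tail) else
      if y.tail.head = Data.nil then
        Data.cons Data.nil (Data.cons (Data.cons Data.nil Data.nil) y.head.tail) else
        Data.cons (Data.cons Data.nil Data.nil) (Data.cons Data.nil y.head.tail) :=
    ite (PTP.eq id.head.head nil) (nil.cons (id.tail.head.cons id.head.tail))
      (ite (PTP.eq id.tail.head nil) (nil.cons ((const _).cons id.head.tail))
        ((const _).cons (nil.cons id.head.tail)))
  have h := foldl (step := fun acc e _ => if acc.head = Data.nil then
      Data.cons Data.nil (Data.cons e acc.tail) else
      if e = Data.nil then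
        Data.cons Data.nil (Data.cons (Data.cons Data.nil Data.nil) acc.tail) else
        Data.cons (Data.cons Data.nil Data.nil) (Data.cons Data.nil acc.tail))
    hstep (const (Data.cons (Data.cons Data.nil Data.nil) Data.nil)) hf (X + 8)
    (fun acc e x => by
      split_ifs with h₁ h₂
      · rcases acc with _ | ⟨a, b⟩ <;> simp <;> omega
      · rcases acc with _ | ⟨a, b⟩ <;> simp <;> omega
      · rcases acc with _ | ⟨a, b⟩
        · simp at h₁
        · have := a.size_pos
          simp; omega)
  -- A carry that survives the last bit becomes a new leading bit.
  have h' := (ite (PTP.eq h.head nil) h.tail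
    ((const (Data.cons Data.nil Data.nil)).cons h.tail)).reverse
  convert h' using 2 with x
  have h₀ : ∀ (l : List Data) (b : Data),
      l.foldl (fun acc e => if acc.head = Data.nil then
        Data.cons Data.nil (Data.cons e acc.tail) else
        if e = Data.nil then
          Data.cons Data.nil (Data.cons (Data.cons Data.nil Data.nil) acc.tail) else
          Data.cons (Data.cons Data.nil Data.nil) (Data.cons Data.nil acc.tail))
        (Data.cons Data.nil b) = Data.cons Data.nil (Data.ofList (l.reverse ++ b.toList)) := by
    intro l
    induction l with
    | nil => simp
    | cons d l ih => intro b; simp [ih]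
  have h₁ : ∀ (d b : Data), (fun z : Data => (if z.head = Data.nil then z.tail
      else Data.cons (Data.cons Data.nil Data.nil) z.tail).toList.reverse)
        (d.toList.foldl (fun acc e => if acc.head = Data.nil then
          Data.cons Data.nil (Data.cons e acc.tail) else
          if e = Data.nil then
            Data.cons Data.nil (Data.cons (Data.cons Data.nil Data.nil) acc.tail) else
            Data.cons (Data.cons Data.nil Data.nil) (Data.cons Data.nil acc.tail))
          (Data.cons (Data.cons Data.nil Data.nil) b)) = b.toList.reverse ++ d.inc.toList := by
    intro d
    induction d with
    | nil => intro b; simp [Data.inc]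
    | cons e l _ ih =>
      intro b
      cases e with
      | nil => simp [Data.inc, h₀]
      | cons e₁ e₂ =>
        have := ih (Data.cons Data.nil b)
        simpa [Data.inc] using this
  have := h₁ (f x) Data.nil
  rw [← Data.ofList_toList (f x).inc]
  congr 1
  simpa using this.symm

theorem lengthBin {f : Data → Data} (hf : PT f) : PT fun x => (f x).lengthBin :=
  foldl (step := fun acc _ _ => acc.inc) id.head.inc (const _) hf 4
    (fun acc e x => by simpa using acc.size_inc_le)

theorem capUnary {f g : Data → Data} (hf : PT f) (hg : PT g) :
    PT fun x => (f x).capUnary (g x) := by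
  classical
  have h := (foldl (step := fun acc _ x => if acc.head = x.head then acc else
      Data.cons acc.head.inc (Data.cons Data.nil acc.tail))
    (init := fun _ => Data.cons (Data.ofNat 0) Data.nil)
    (ite (PTP.eq id.head.head id.tail.tail.head) id.head
      (id.head.head.inc.cons (nil.cons id.head.tail))) (const _) id.tail 10
    (fun acc e x => by
      split_ifs
      · simp
      · have := acc.head.size_inc_le
        rcases acc with _ | ⟨a, b⟩ <;> simp at this ⊢ <;> omega)).tail.comp (hf.cons hg)
  exact h

theorem rot {f : Data → Data} (hf : PT f) : PT fun x => (f x).rot := by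
  classical
  have h := ite (PTP.eq hf nil) nil (append hf.tail (hf.head.cons nil))
  convert h using 2 with x
  cases f x <;> simp [Data.rot]

theorem rotMatrix {f : Data → Data} (hf : PT f) : PT fun x => (f x).rotMatrix :=
  rot (map (g := fun e _ => e.rot) id.head.rot hf)

theorem delMatrix {f : Data → Data} (hf : PT f) : PT fun x => (f x).delMatrix :=
  map (g := fun e _ => e.tail) id.head.tail hf.tail

theorem flat {f : Data → Data} (hf : PT f) : PT fun x => (f x).flat :=
  foldl (step := fun acc e _ => Data.ofList (e.toList ++ acc.toList))
    (append id.tail.head id.head) nil hf X (fun acc e x => by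
      have h₁ := Data.size_ofList acc.toList
      have h₂ := Data.size_ofList e.toList
      rw [Data.ofList_toList] at h₁ h₂
      simp only [Data.size_ofList, List.map_append, List.sum_append, eval_X]
      omega)

end PT

/-! ### The kernelization as a function on encodings -/

namespace Data

/-- The columns in which the row `r` has a nonzero entry and the row `s` has not. -/
noncomputable def diff (r s : Data) : Data :=
  open Classical in
  ofList ((List.zipWith cons r.toList s.toList).filter fun e => e.head ≠ nil ∧ e.tail = nil)

/-- The list has exactly one element. -/
def IsSingle (d : Data) : Prop := d ≠ nil ∧ d.tail = nil

/-- For the rows of `M`, the columns in which they have a nonzero entry and the first row has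
not. -/
noncomputable def twinMarks (M : Data) : Data :=
  ofList (M.toList.map fun s => diff s M.head)

/-- The twins of the first vertex of `M` that have the same entry `x` in the row `s`. -/
noncomputable def sameTwins (x s M : Data) : Data :=
  open Classical in
  ofList ((List.zipWith cons (List.zipWith cons M.head.toList M.twinMarks.toList)
    s.toList).filter fun f => f.head.head ≠ nil ∧ IsSingle f.head.tail ∧ f.tail = x)

/-- The test whether the first vertex of `M` may be deleted. -/
def Test (W M : Data) : Prop :=
  ∀ e ∈ (ofList (List.zipWith cons M.head.toList M.toList)).toList, e.head ≠ nil →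
    IsSingle (diff M.head e.tail) ∧ (e.head = W ∨
      (diff e.tail M.head).toList.length ≤
        (cons nil (sameTwins e.head e.tail M)).toList.length)

/-- The entries `W` of the first row. -/
noncomputable def forced (W M : Data) : Data :=
  open Classical in ofList (M.head.toList.filter fun e => e = W)

/-- One step of the kernelization: the first vertex is deleted, or it becomes the last one. -/
noncomputable def step (W acc : Data) : Data :=
  open Classical in
  if Test W acc.tail then
    cons (ofList (acc.head.toList.drop (forced W acc.tail).toList.length)) acc.tail.delMatrix
  else cons acc.head acc.tail.rotMatrix

/-- The reduction of a matrix `M` and a number `k`. -/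
noncomputable def reduce (W k M : Data) : Data :=
  M.toList.foldl (fun acc _ => step W acc) (cons (cons nil (capUnary k M.flat)) M)

/-- The matrix of a graph that is a single edge which has to be weak. -/
def edgeMatrix : Data :=
  ofList [ofList [nil, cons nil nil], ofList [cons nil nil, nil]]

/-- The number `k` of the resulting instance. -/
noncomputable def budget (s : Data) : Data :=
  lengthBin (ofList (List.zipWith cons s.head.tail.toList s.tail.flat.toList))

/-- The kernelization for EL-Multi-STC. -/
noncomputable def kernelEL (x : Data) : Data :=
  open Classical in
  if (reduce (cons nil nil) x.tail.head x.tail.tail).head = nil then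
    cons x.head (cons nil edgeMatrix)
  else cons x.head (cons (budget (reduce (cons nil nil) x.tail.head x.tail.tail))
    (reduce (cons nil nil) x.tail.head x.tail.tail).tail)

/-- The weak entries for Multi-STC: all edges if there are no colours, and none otherwise. -/
noncomputable def weakEntry (c : Data) : Data :=
  open Classical in if c = nil then cons nil nil else cons nil (cons nil nil)

/-- The state of the kernelization for Multi-STC after the reduction. -/
noncomputable def reduceMulti (x : Data) : Data :=
  reduce (weakEntry x.head) x.tail.head x.tail.tail

/-- The kernelization for Multi-STC. -/
noncomputable def kernelMulti (x : Data) : Data :=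
  open Classical in
  if (reduceMulti x).head = nil then cons nil (cons nil edgeMatrix)
  else cons (lengthBin (capUnary x.head (reduceMulti x).tail.flat))
    (cons (budget (reduceMulti x)) (reduceMulti x).tail)

theorem size_step_le (W acc : Data) : (step W acc).size ≤ acc.size + 2 := by
  rw [step]
  split_ifs
  · have h₁ := size_delMatrix_le acc.tail
    have h₂ : (ofList (acc.head.toList.drop (forced W acc.tail).toList.length)).size
        ≤ acc.head.size := by
      conv_rhs => rw [← ofList_toList acc.head]
      rw [size_ofList, size_ofList, List.map_drop]
      exact Nat.add_le_add_right ((List.drop_sublist _ _).sum_le_sum (by simp)) 1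
    rcases acc with _ | ⟨a, b⟩ <;> simp at h₁ h₂ ⊢ <;> omega
  · rcases acc with _ | ⟨a, b⟩ <;> simp [size_rotMatrix]

end Data

/-! ### The kernelization runs in polynomial time -/

namespace PT

theorem diff {f g : Data → Data} (hf : PT f) (hg : PT g) : PT fun x => (f x).diff (g x) := by
  classical
  have := filter (P := fun e _ => e.head ≠ Data.nil ∧ e.tail = Data.nil)
    ((PTP.ne_nil id.head.head).and (PTP.eq id.head.tail nil)) (hf.zip hg)
  convert this using 2 with x
  rw [Data.diff, Data.toList_ofList]

theorem _root_.STC.PTP.isSingle {f : Data → Data} (hf : PT f) : PTP fun x => (f x).IsSingle :=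
  (PTP.ne_nil hf).and (PTP.eq hf.tail nil)

theorem twinMarks {f : Data → Data} (hf : PT f) : PT fun x => (f x).twinMarks :=
  (map (g := fun s M => Data.diff s M.head) (id.head.diff id.tail.head) id).comp hf

theorem sameTwins {f g h : Data → Data} (hf : PT f) (hg : PT g) (hh : PT h) :
    PT fun x => (f x).sameTwins (g x) (h x) := by
  classical
  have hM : PT fun y : Data => y.tail.tail := id.tail.tail
  have := (filter (P := fun e y => e.head.head ≠ Data.nil ∧ e.head.tail.IsSingle ∧ e.tail = y.head)
    ((PTP.ne_nil id.head.head.head).and ((PTP.isSingle id.head.head.tail).and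
      (PTP.eq id.head.tail id.tail.head)))
    ((hM.head.zip hM.twinMarks).zip id.tail.head)).comp (hf.cons (hg.cons hh))
  convert this using 2 with x
  simp only [Data.sameTwins, Data.toList_ofList, Data.head_cons, Data.tail_cons]
  exact congrArg Data.ofList (List.filter_congr fun e _ => decide_eq_decide.2 Iff.rfl)

theorem _root_.STC.PTP.test {f g : Data → Data} (hf : PT f) (hg : PT g) :
    PTP fun x => Data.Test (f x) (g x) := by
  have hM : PT fun y : Data => y.tail.tail := id.tail.tail
  have := PTP.forall_mem (P := fun e y => e.head ≠ Data.nil →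
      (Data.diff y.tail.head e.tail).IsSingle ∧ (e.head = y.head ∨
      (Data.diff e.tail y.tail.head).toList.length ≤
        (Data.cons Data.nil (Data.sameTwins e.head e.tail y.tail)).toList.length))
    ((PTP.ne_nil id.head.head).imp ((PTP.isSingle (hM.head.diff id.head.tail)).and
      ((PTP.eq id.head.head id.tail.head).or (PTP.length_le (id.head.tail.diff hM.head)
        (nil.cons (id.head.head.sameTwins id.head.tail hM))))))
    (id.tail.head.zip id.tail)
  exact this.comp (hf.cons hg)

theorem forced {f g : Data → Data} (hf : PT f) (hg : PT g) :
    PT fun x => Data.forced (f x) (g x) := by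
  classical
  have := (filter (P := fun e y => e = y.head) (PTP.eq id.head id.tail.head)
    id.tail.head).comp (hf.cons hg)
  convert this using 2 with x
  rw [Data.forced]; rfl

theorem step {f g : Data → Data} (hf : PT f) (hg : PT g) :
    PT fun x => Data.step (f x) (g x) := by
  classical
  exact ite (PTP.test hf hg.tail) ((drop hg.head (forced hf hg.tail)).cons hg.tail.delMatrix)
    (hg.head.cons hg.tail.rotMatrix)

theorem reduce {f g h : Data → Data} (hf : PT f) (hg : PT g) (hh : PT h) :
    PT fun x => Data.reduce (f x) (g x) (h x) := by
  have := (foldl (step := fun acc _ x => Data.step x.head acc) (step id.tail.tail.head id.head)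
    ((nil.cons (capUnary id.tail.head (flat id.tail.tail))).cons id.tail.tail) id.tail.tail 2
    (fun acc e x => by simpa using Data.size_step_le x.head acc)).comp (hf.cons (hg.cons hh))
  exact this

theorem budget {f : Data → Data} (hf : PT f) : PT fun x => (f x).budget :=
  lengthBin (hf.head.tail.zip hf.tail.flat)

theorem kernelEL : PT Data.kernelEL := by
  classical
  have h : PT fun x => Data.reduce (Data.cons Data.nil Data.nil) x.tail.head x.tail.tail :=
    (const _).reduce id.tail.head id.tail.tail
  exact ite (PTP.eq h.head nil) (id.head.cons (nil.cons (const _)))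
    (id.head.cons (h.budget.cons h.tail))

theorem kernelMulti : PT Data.kernelMulti := by
  classical
  have hW : PT fun x => Data.weakEntry x.head :=
    ite (PTP.eq id.head nil) (const _) (const _)
  have h : PT Data.reduceMulti := hW.reduce id.tail.head id.tail.tail
  exact ite (PTP.eq h.head nil) (nil.cons (nil.cons (const _)))
    ((id.head.capUnary h.tail.flat).lengthBin.cons (h.budget.cons h.tail))

end PT

/-! ### The reduction on lists of vertices -/

section Spec

variable {V : Type*} (A : V → V → Data) (W : Data)

/-- The matrix `A`, restricted to a list of vertices. -/
def mat (l : List V) : Data := Data.ofList (l.map fun a => Data.ofList (l.map (A a)))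

open Classical in
/-- The number of vertices of `l` that are adjacent to `a`, but not to `b`. -/
noncomputable def diffCount (l : List V) (a b : V) : ℕ :=
  (l.filter fun w => A a w ≠ Data.nil ∧ A b w = Data.nil).length

open Classical in
/-- The condition under which the vertex `v` of the list `l` is deleted. -/
def Removable (l : List V) (v : V) : Prop :=
  ∀ u ∈ l, A v u ≠ Data.nil → diffCount A l v u = 1 ∧ (A v u = W ∨
    diffCount A l u v ≤ (l.filter fun v' =>
      A v v' ≠ Data.nil ∧ diffCount A l v' v = 1 ∧ A u v' = A v u).length + 1)

open Classical in
/-- The number of entries `W` of `v`. -/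
noncomputable def forcedCount (l : List V) (v : V) : ℕ := (l.filter fun u => A v u = W).length

open Classical in
/-- The vertices of the first list are considered one after the other; those that are not deleted
are appended to the second list. -/
noncomputable def sweep : List V → List V → ℕ → ℕ × List V
  | [], l, K => (K, l)
  | v :: t, l, K =>
    if Removable A W (v :: t ++ l) v then
      sweep t l (K - forcedCount A W (v :: t ++ l) v)
    else sweep t (l ++ [v]) K

variable {A W}

theorem isSingle_iff (d : Data) : d.IsSingle ↔ d.toList.length = 1 := by
  rcases d with _ | ⟨a, _ | ⟨b, c⟩⟩ <;> simp [Data.IsSingle]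

theorem length_diff (l : List V) (a b : V) :
    (Data.diff (Data.ofList (l.map (A a))) (Data.ofList (l.map (A b)))).toList.length
      = diffCount A l a b := by
  simp only [Data.diff, diffCount, Data.toList_ofList, List.zipWith_map, List.zipWith_self,
    List.filter_map, List.length_map]
  rfl

open Classical in
theorem length_sameTwins (x : Data) (v u : V) (t : List V) :
    (Data.sameTwins x (Data.ofList ((v :: t).map (A u))) (mat A (v :: t))).toList.length
      = ((v :: t).filter fun v' =>
        A v v' ≠ Data.nil ∧ diffCount A (v :: t) v' v = 1 ∧ A u v' = x).length := by
  have hM : (mat A (v :: t)).head = Data.ofList ((v :: t).map (A v)) := rfl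
  simp only [Data.sameTwins, Data.twinMarks, hM]
  simp only [mat, Data.toList_ofList, List.map_map, List.zipWith_map, List.zipWith_self,
    List.filter_map, List.length_map, Function.comp_def, Data.head_cons, Data.tail_cons]
  exact congrArg List.length (List.filter_congr fun v' _ =>
    decide_eq_decide.2 (by simp only [isSingle_iff, length_diff]))

theorem test_mat (v : V) (t : List V) :
    Data.Test W (mat A (v :: t)) ↔ Removable A W (v :: t) v := by
  have hM : (mat A (v :: t)).head = Data.ofList ((v :: t).map (A v)) := rfl
  rw [Data.Test, Removable]
  have : List.zipWith Data.cons (mat A (v :: t)).head.toList (mat A (v :: t)).toList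
      = (v :: t).map fun u => Data.cons (A v u) (Data.ofList ((v :: t).map (A u))) := by
    rw [hM, mat, Data.toList_ofList, Data.toList_ofList, List.zipWith_map, List.zipWith_self]
  rw [Data.toList_ofList, this, List.forall_mem_map]
  refine forall₂_congr fun u _ => ?_
  simp only [Data.head_cons, Data.tail_cons, isSingle_iff, hM, length_diff, Data.toList_cons,
    List.length_cons (as := (Data.sameTwins _ _ _).toList), length_sameTwins]

theorem length_forced (v : V) (t : List V) :
    (Data.forced W (mat A (v :: t))).toList.length = forcedCount A W (v :: t) v := by
  have hM : (mat A (v :: t)).head = Data.ofList ((v :: t).map (A v)) := rfl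
  rw [Data.forced, hM, forcedCount, Data.toList_ofList, Data.toList_ofList, List.filter_map,
    List.length_map]
  rfl

theorem rotMatrix_mat (v : V) (t : List V) : (mat A (v :: t)).rotMatrix = mat A (t ++ [v]) := by
  have h : ∀ (a : V), (Data.ofList ((v :: t).map (A a))).rot
      = Data.ofList ((t ++ [v]).map (A a)) := fun a => by simp [Data.rot]
  rw [Data.rotMatrix, mat, Data.toList_ofList, List.map_map]
  simp only [Function.comp_def, h]
  simp [Data.rot, mat]

theorem delMatrix_mat (v : V) (t : List V) : (mat A (v :: t)).delMatrix = mat A t := by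
  simp [Data.delMatrix, mat, Function.comp_def]

theorem step_mat (v : V) (t : List V) (K : ℕ) [Decidable (Removable A W (v :: t) v)] :
    Data.step W (Data.cons (Data.unary K) (mat A (v :: t))) =
      if Removable A W (v :: t) v then
        Data.cons (Data.unary (K - forcedCount A W (v :: t) v)) (mat A t)
      else Data.cons (Data.unary K) (mat A (t ++ [v])) := by
  rw [Data.step]
  simp only [Data.head_cons, Data.tail_cons, test_mat, length_forced, rotMatrix_mat,
    delMatrix_mat, Data.toList_unary, List.drop_replicate]
  rfl

/-- The list `m` is only a clock. The untested vertices `s` stand in front of the retained ones `l`,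
so after `s.length` rotations or deletions each vertex of `s` has been tested once. -/
theorem foldl_step_mat (m : List Data) (s l : List V) (K : ℕ) (h : m.length = s.length) :
    m.foldl (fun acc _ => Data.step W acc) (Data.cons (Data.unary K) (mat A (s ++ l)))
      = Data.cons (Data.unary (sweep A W s l K).1) (mat A (sweep A W s l K).2) := by
  classical
  induction m generalizing s l K with
  | nil =>
    obtain rfl : s = [] := List.length_eq_zero_iff.1 (by simpa using h.symm)
    simp [sweep]
  | cons a m ih =>
    cases s with
    | nil => simp at h
    | cons v t =>
      have h' : m.length = t.length := by simpa using h
      rw [List.foldl_cons, List.cons_append, step_mat, sweep, List.cons_append]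
      split_ifs
      · rw [ih _ _ _ h']
      · rw [List.append_assoc, ih _ _ _ h']

theorem length_flat_mat (l : List V) : (mat A l).flat.toList.length = l.length ^ 2 := by
  rw [Data.length_flat, mat, Data.toList_ofList, List.map_map]
  simp [Function.comp_def, sq]

theorem reduce_mat (k : ℕ) (l : List V) :
    Data.reduce W (Data.ofNat k) (mat A l)
      = Data.cons (Data.unary (sweep A W l [] (min k (l.length ^ 2) + 1)).1)
        (mat A (sweep A W l [] (min k (l.length ^ 2) + 1)).2) := by
  rw [Data.reduce, Data.capUnary_ofNat, length_flat_mat]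
  have := foldl_step_mat (A := A) (W := W) (mat A l).toList l [] (min k (l.length ^ 2) + 1)
    (by simp [mat])
  rw [List.append_nil] at this
  rw [← this]
  rfl

/-- The counter is one more than the number of weak edges still allowed, so that `0` can signal a
No-instance; hence `K - 1`. -/
theorem budget_mat (K : ℕ) (l : List V) :
    Data.budget (Data.cons (Data.unary K) (mat A l)) = Data.ofNat (min (K - 1) (l.length ^ 2)) := by
  rw [Data.budget, Data.lengthBin_eq, Data.toList_ofList, List.length_zipWith, Data.tail_cons,
    length_flat_mat, Data.head_cons]
  cases K <;> simp [Data.unary, List.replicate_succ]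

end Spec

/-! ### Labelings on a set of vertices -/

section Deletion

variable {V : Type*} (G : SimpleGraph V) {c : ℕ} (Ψ : Sym2 V → Finset (Fin c))

/-- `L` is a `Ψ`-satisfying STC-labeling of the subgraph induced by `S`. -/
def Good (S : Finset V) (L : Sym2 V → Option (Fin c)) : Prop :=
  (∀ u ∈ S, ∀ v ∈ S, ∀ w ∈ S, G.Adj u v → G.Adj v w → u ≠ w → ∀ i,
    L s(u, v) = some i → L s(v, w) = some i → G.Adj u w) ∧
  ∀ u ∈ S, ∀ v ∈ S, G.Adj u v → ∀ i, L s(u, v) = some i → i ∈ Ψ s(u, v)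

open Classical in
/-- The weak edges in the subgraph induced by `S`. -/
noncomputable def weakSet (S : Finset V) (L : Sym2 V → Option (Fin c)) : Finset (Sym2 V) :=
  S.sym2.filter fun e => e ∈ G.edgeSet ∧ L e = none

/-- The subgraph induced by `S` has a labeling with less than `K` weak edges. -/
def YesOn (S : Finset V) (K : ℕ) : Prop :=
  ∃ L : Sym2 V → Option (Fin c), Good G Ψ S L ∧ (weakSet G S L).card < K

open Classical in
/-- The ends of the edges at `u` in `S` that are in conflict with `{u, v}`. -/
noncomputable def conflicts (S : Finset V) (v u : V) : Finset V :=
  S.filter fun w => G.Adj u w ∧ w ≠ v ∧ ¬ G.Adj v w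

open Classical in
/-- The vertices of `S` that are adjacent to `u` and to `v`, with the same list at `u`, and that
have no further neighbours outside the neighbourhood of `v`. -/
noncomputable def twins (S : Finset V) (v u : V) : Finset V :=
  S.filter fun x => G.Adj v x ∧ (∀ w ∈ S, G.Adj x w → w = v ∨ G.Adj v w) ∧ G.Adj u x ∧
    Ψ s(x, u) = Ψ s(v, u)

/-- The condition under which the vertex `v` may be deleted from `S`. -/
def Deletable (S : Finset V) (v : V) : Prop :=
  (∀ u ∈ S, ∀ w ∈ S, G.Adj v u → G.Adj v w → u ≠ w → G.Adj u w) ∧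
  ∀ u ∈ S, G.Adj v u → Ψ s(v, u) = ∅ ∨ (conflicts G S v u).card ≤ (twins G Ψ S v u).card

open Classical in
/-- The number of edges at `v` in `S` with an empty list. -/
noncomputable def emptyCount (S : Finset V) (v : V) : ℕ :=
  (S.filter fun u => G.Adj v u ∧ Ψ s(v, u) = ∅).card

variable {G Ψ}

theorem mk_mem_weakSet {S : Finset V} {L : Sym2 V → Option (Fin c)} {a b : V} :
    s(a, b) ∈ weakSet G S L ↔ (a ∈ S ∧ b ∈ S) ∧ G.Adj a b ∧ L s(a, b) = none := by
  simp [weakSet]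

theorem mem_conflicts {S : Finset V} {v u w : V} :
    w ∈ conflicts G S v u ↔ w ∈ S ∧ G.Adj u w ∧ w ≠ v ∧ ¬ G.Adj v w := by
  simp [conflicts]

theorem mem_twins {S : Finset V} {v u x : V} :
    x ∈ twins G Ψ S v u ↔ x ∈ S ∧ G.Adj v x ∧ (∀ w ∈ S, G.Adj x w → w = v ∨ G.Adj v w) ∧
      G.Adj u x ∧ Ψ s(x, u) = Ψ s(v, u) := by
  simp [twins]

theorem Good.mono {S S' : Finset V} {L : Sym2 V → Option (Fin c)} (h : Good G Ψ S L)
    (hS : S' ⊆ S) : Good G Ψ S' L :=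
  ⟨fun u hu v hv w hw => h.1 u (hS hu) v (hS hv) w (hS hw),
    fun u hu v hv => h.2 u (hS hu) v (hS hv)⟩

variable [DecidableEq V]

open Classical in
theorem card_weakSet_erase {S : Finset V} {v : V} (hv : v ∈ S) (L : Sym2 V → Option (Fin c)) :
    (weakSet G S L).card = (weakSet G (S.erase v) L).card +
      (S.filter fun u => G.Adj v u ∧ L s(v, u) = none).card := by
  have hinj : Function.Injective fun u => s(v, u) := fun a b h => Sym2.congr_right.1 h
  rw [← Finset.card_image_of_injective (S.filter fun u => G.Adj v u ∧ L s(v, u) = none) hinj,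
    ← Finset.card_union_of_disjoint]
  · congr 1
    ext e
    induction e with | _ a b
    rw [Finset.mem_union, mk_mem_weakSet, mk_mem_weakSet, Finset.mem_image]
    simp only [Finset.mem_erase, Finset.mem_filter]
    constructor
    · rintro ⟨⟨ha, hb⟩, hab, hL⟩
      by_cases h : a = v
      · subst h
        exact Or.inr ⟨b, ⟨hb, hab, hL⟩, rfl⟩
      by_cases h' : b = v
      · subst h'
        exact Or.inr ⟨a, ⟨ha, hab.symm, by rwa [Sym2.eq_swap]⟩, Sym2.eq_swap⟩
      · exact Or.inl ⟨⟨⟨h, ha⟩, h', hb⟩, hab, hL⟩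
    · rintro (⟨⟨⟨_, ha⟩, _, hb⟩, h⟩ | ⟨u, ⟨hu, hvu, hL⟩, h⟩)
      · exact ⟨⟨ha, hb⟩, h⟩
      · rw [← h]
        rcases Sym2.eq_iff.1 h with ⟨rfl, rfl⟩ | ⟨rfl, rfl⟩
        · exact ⟨⟨hv, hu⟩, hvu, hL⟩
        · exact ⟨⟨hu, hv⟩, hvu.symm, hL⟩
  · rw [Finset.disjoint_left]
    intro e he he'
    obtain ⟨u, _, rfl⟩ := Finset.mem_image.1 he'
    simpa using (mk_mem_weakSet.1 he).1.1

/-- A labeling of `S` without `v` can be changed in such a way that the edge `{v, u}` has a colour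
that is not in conflict. -/
theorem exists_recoloring {S : Finset V} {v : V} (hdel : Deletable G Ψ S v)
    {L : Sym2 V → Option (Fin c)} (hL : Good G Ψ (S.erase v) L) {u : V} (hu : u ∈ S)
    (hvu : G.Adj v u) (hΨ : (Ψ s(v, u)).Nonempty) :
    ∃ L' : Sym2 V → Option (Fin c), Good G Ψ (S.erase v) L' ∧
      (weakSet G (S.erase v) L').card ≤ (weakSet G (S.erase v) L).card ∧
      (∃ i ∈ Ψ s(v, u), ∀ w ∈ conflicts G S v u, L' s(u, w) ≠ some i) ∧
      ∀ a b i, ¬ G.Adj v b → L' s(a, b) = some i → L s(a, b) = some i := by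
  classical
  -- If a twin edge `xu` is strong, its colour is allowed for `vu`, the lists being equal. A
  -- conflict edge `uw` of that colour would force `xw` to be an edge, contrary to `N(x) ⊆ N[v]`. So
  -- nothing needs to change.
  by_cases hstrong : ∃ x ∈ twins G Ψ S v u, ∃ i, L s(x, u) = some i
  · obtain ⟨x, hx, i, hi⟩ := hstrong
    obtain ⟨hxS, hvx, hx', hux, hlist⟩ := mem_twins.1 hx
    refine ⟨L, hL, le_rfl, ⟨i, ?_, fun w hw hwi => ?_⟩, fun _ _ _ _ h => h⟩
    · rw [← hlist]
      exact hL.2 x (Finset.mem_erase.2 ⟨hvx.ne', hxS⟩) u (Finset.mem_erase.2 ⟨hvu.ne', hu⟩)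
        hux.symm i hi
    · obtain ⟨hwS, huw, hwv, hvw⟩ := mem_conflicts.1 hw
      have hxw : x ≠ w := by rintro rfl; exact hvw hvx
      have := hL.1 x (Finset.mem_erase.2 ⟨hvx.ne', hxS⟩) u (Finset.mem_erase.2 ⟨hvu.ne', hu⟩)
        w (Finset.mem_erase.2 ⟨hwv, hwS⟩) hux.symm huw hxw i hi hwi
      rcases hx' w hwS this with h | h
      · exact hwv h
      · exact hvw h
  -- Now all twin edges at `u` are weak. They form `T` and receive a colour `i` of the list; the
  -- conflict edges form `E` and become weak.
  · push Not at hstrong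
    obtain ⟨i, hi⟩ := hΨ
    have hcard := (hdel.2 u hu hvu).resolve_left (fun h => by simp [h] at hi)
    let T := (twins G Ψ S v u).image fun x => s(x, u)
    let E := (conflicts G S v u).image fun w => s(u, w)
    -- Edges of `T` lie inside `N(v)`. Strong edges outside `E` at either end lead into `N[v]`: at a
    -- twin by definition, at `u` because all others belong to `E`. The clique `N(v)` then closes
    -- every new monochromatic path.
    have hTmem : ∀ {a b : V}, s(a, b) ∈ T → G.Adj v a ∧ G.Adj v b ∧
        (∀ w ∈ S, G.Adj a w → G.Adj b w → w = v ∨ G.Adj v w) ∧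
        (∀ d ∈ S, G.Adj b d → L s(b, d) ≠ none → s(b, d) ∉ E → d = v ∨ G.Adj v d) := by
      intro a b hab
      obtain ⟨x, hx, h⟩ := Finset.mem_image.1 hab
      obtain ⟨hxS, hvx, hx', hux, hlist⟩ := mem_twins.1 hx
      have hE : ∀ d ∈ S, G.Adj u d → s(u, d) ∉ E → d = v ∨ G.Adj v d := by
        intro d hd hud hE
        by_contra! h'
        exact hE (Finset.mem_image_of_mem _ (mem_conflicts.2 ⟨hd, hud, h'.1, h'.2⟩))
      rcases Sym2.eq_iff.1 h with ⟨rfl, rfl⟩ | ⟨rfl, rfl⟩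
      · exact ⟨hvx, hvu, fun w hw h₁ _ => hx' w hw h₁, fun d hd h₁ _ h₂ => hE d hd h₁ h₂⟩
      · exact ⟨hvu, hvx, fun w hw _ h₁ => hx' w hw h₁, fun d hd h₁ _ _ => hx' d hd h₁⟩
    have hdisj : ∀ {e}, e ∈ T → e ∉ E := by
      intro e he he'
      obtain ⟨w, hw, rfl⟩ := Finset.mem_image.1 he'
      exact (mem_conflicts.1 hw).2.2.2 (hTmem he).2.1
    let L' : Sym2 V → Option (Fin c) := fun e =>
      if e ∈ T then some i else if e ∈ E then none else L e
    have hL'some : ∀ {e j}, L' e = some j → e ∉ E ∧ (e ∉ T → L e = some j) := by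
      intro e j h
      by_cases hT : e ∈ T
      · exact ⟨hdisj hT, fun h' => absurd hT h'⟩
      · by_cases hE : e ∈ E
        · simp [L', hT, hE] at h
        · exact ⟨hE, fun _ => by simpa [L', hT, hE] using h⟩
    -- an edge of `T` and a strong edge at one of its ends are in the neighbourhood of `v`
    have hTstrong : ∀ {a b d : V} {j}, d ∈ S.erase v → s(a, b) ∈ T → G.Adj b d →
        L' s(b, d) = some j → a ≠ d → a ∈ S → G.Adj a d := by
      intro a b d j hd hab hbd hj had ha
      obtain ⟨h₁, h₂, _, h₃⟩ := hTmem hab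
      refine hdel.1 a ha d (Finset.mem_of_mem_erase hd) h₁ ?_ had
      by_cases hT : s(b, d) ∈ T
      · exact (hTmem hT).2.1
      · exact (h₃ d (Finset.mem_of_mem_erase hd) hbd (by simp [(hL'some hj).2 hT])
          (hL'some hj).1).resolve_left (Finset.ne_of_mem_erase hd)
    refine ⟨L', ⟨?_, ?_⟩, ?_, ⟨i, hi, ?_⟩, ?_⟩
    · intro a ha b hb d hd hab hbd had j h₁ h₂
      by_cases hT : s(a, b) ∈ T
      · exact hTstrong hd hT hbd h₂ had (Finset.mem_of_mem_erase ha)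
      · by_cases hT' : s(b, d) ∈ T
        · rw [Sym2.eq_swap] at hT' h₁
          exact (hTstrong ha hT' hab.symm h₁ had.symm (Finset.mem_of_mem_erase hd)).symm
        · exact hL.1 a ha b hb d hd hab hbd had j ((hL'some h₁).2 hT) ((hL'some h₂).2 hT')
    · intro a ha b hb hab j hj
      by_cases hT : s(a, b) ∈ T
      · obtain ⟨x, hx, h⟩ := Finset.mem_image.1 hT
        have hj' : i = j := by simpa [L', hT] using hj
        rw [← h, ← hj', (mem_twins.1 hx).2.2.2.2]
        exact hi
      · exact hL.2 a ha b hb hab j ((hL'some hj).2 hT)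
    -- The set `T` leaves the weak edges and at most `E` enters, so `conflicts ≤ twins` keeps the
    -- count from growing.
    · have hTsub : T ⊆ weakSet G (S.erase v) L := by
        intro e he
        obtain ⟨x, hx, rfl⟩ := Finset.mem_image.1 he
        obtain ⟨hxS, hvx, hx', hux, hlist⟩ := mem_twins.1 hx
        refine mk_mem_weakSet.2 ⟨⟨Finset.mem_erase.2 ⟨hvx.ne', hxS⟩,
          Finset.mem_erase.2 ⟨hvu.ne', hu⟩⟩, hux.symm, ?_⟩
        exact Option.eq_none_iff_forall_ne_some.2 (hstrong x hx)
      have hsub : weakSet G (S.erase v) L' ⊆ (weakSet G (S.erase v) L \ T) ∪ E := by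
        intro e he
        simp only [weakSet, Finset.mem_filter, Finset.mem_union, Finset.mem_sdiff] at he ⊢
        obtain ⟨he₁, he₂, he₃⟩ := he
        by_cases hT : e ∈ T
        · simp [L', hT] at he₃
        · by_cases hE : e ∈ E
          · exact Or.inr hE
          · exact Or.inl ⟨⟨he₁, he₂, by simpa [L', hT, hE] using he₃⟩, hT⟩
      have hT : T.card = (twins G Ψ S v u).card :=
        Finset.card_image_of_injective _ fun a b h => Sym2.congr_left.1 h
      have hE : E.card ≤ (conflicts G S v u).card := Finset.card_image_le
      have h₁ := Finset.card_le_card hsub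
      have h₂ := Finset.card_union_le (weakSet G (S.erase v) L \ T) E
      have h₃ := Finset.card_sdiff_add_card_eq_card hTsub
      omega
    · intro w hw h
      exact (hL'some h).1 (Finset.mem_image_of_mem _ hw)
    · intro a b j hb h
      exact (hL'some h).2 fun hT => hb (hTmem hT).2.1

/-- The neighbours are treated one at a time. A conflict edge has an end outside `N(v)`, and on such
edges a recoloring never creates a strong label, so colours freed earlier stay free. -/
theorem exists_recoloring_all {S : Finset V} {v : V} (hdel : Deletable G Ψ S v)
    {L : Sym2 V → Option (Fin c)} (hL : Good G Ψ (S.erase v) L) (U : Finset V)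
    (hU : ∀ u ∈ U, u ∈ S ∧ G.Adj v u ∧ (Ψ s(v, u)).Nonempty) :
    ∃ L' : Sym2 V → Option (Fin c), Good G Ψ (S.erase v) L' ∧
      (weakSet G (S.erase v) L').card ≤ (weakSet G (S.erase v) L).card ∧
      ∀ u ∈ U, ∃ i ∈ Ψ s(v, u), ∀ w ∈ conflicts G S v u, L' s(u, w) ≠ some i := by
  classical
  induction U using Finset.induction_on with
  | empty => exact ⟨L, hL, le_rfl, by simp⟩
  | insert u U _ ih =>
    obtain ⟨L₁, hL₁, hcard₁, h₁⟩ := ih fun u' hu' => hU u' (Finset.mem_insert_of_mem hu')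
    obtain ⟨huS, hvu, hΨ⟩ := hU u (Finset.mem_insert_self _ _)
    obtain ⟨L₂, hL₂, hcard₂, h₂, h₂'⟩ := exists_recoloring hdel hL₁ huS hvu hΨ
    refine ⟨L₂, hL₂, hcard₂.trans hcard₁, fun u' hu' => ?_⟩
    rcases Finset.mem_insert.1 hu' with rfl | hu'
    · exact h₂
    · obtain ⟨i, hi, h⟩ := h₁ u' hu'
      exact ⟨i, hi, fun w hw hw' => h w hw (h₂' _ _ _ (mem_conflicts.1 hw).2.2.2 hw')⟩

/-- Each edge `vu` with a nonempty list takes the colour freed for it. Two edges meeting at `v`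
never clash because `N(v)` is a clique, so only clashes at `u` with conflict edges matter, and these
have been excluded. -/
theorem exists_extension {S : Finset V} {v : V} (hv : v ∈ S) (hdel : Deletable G Ψ S v)
    {L : Sym2 V → Option (Fin c)} (hL : Good G Ψ (S.erase v) L) :
    ∃ L' : Sym2 V → Option (Fin c), Good G Ψ S L' ∧
      (weakSet G S L').card ≤ (weakSet G (S.erase v) L).card + emptyCount G Ψ S v := by
  classical
  obtain ⟨L₁, hL₁, hcard, h⟩ := exists_recoloring_all hdel hL
    (S.filter fun u => G.Adj v u ∧ (Ψ s(v, u)).Nonempty) (by simp)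
  have h' : ∀ u, ∃ o : Option (Fin c), (u ∈ S → G.Adj v u → (Ψ s(v, u)).Nonempty →
      ∃ i ∈ Ψ s(v, u), o = some i ∧ ∀ w ∈ conflicts G S v u, L₁ s(u, w) ≠ some i) ∧
      (¬ (Ψ s(v, u)).Nonempty → o = none) := by
    intro u
    by_cases hu : u ∈ S ∧ G.Adj v u ∧ (Ψ s(v, u)).Nonempty
    · obtain ⟨i, hi, hi'⟩ := h u (by simpa using hu)
      exact ⟨some i, fun _ _ _ => ⟨i, hi, rfl, hi'⟩, fun h => absurd hu.2.2 h⟩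
    · exact ⟨none, fun h₁ h₂ h₃ => absurd ⟨h₁, h₂, h₃⟩ hu, fun _ => rfl⟩
  choose col hcol using h'
  -- Pairs containing `v` are coloured through their other end; all remaining pairs keep the
  -- recoloured label.
  let L' : Sym2 V → Option (Fin c) := fun e =>
    if h : v ∈ e then col (Sym2.Mem.other h) else L₁ e
  have hL'v : ∀ {u}, L' s(v, u) = col u := by
    intro u
    have h : v ∈ s(v, u) := Sym2.mem_mk_left v u
    simp only [L', dif_pos h, Sym2.congr_right.1 (Sym2.other_spec h)]
  have hcol' : ∀ {u i}, u ∈ S → G.Adj v u → col u = some i →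
      i ∈ Ψ s(v, u) ∧ ∀ w ∈ conflicts G S v u, L₁ s(u, w) ≠ some i := by
    intro u i hu hvu hi
    by_cases hne : (Ψ s(v, u)).Nonempty
    · obtain ⟨j, hj, hj', hj''⟩ := (hcol u).1 hu hvu hne
      obtain rfl : j = i := Option.some_injective _ (hj'.symm.trans hi)
      exact ⟨hj, hj''⟩
    · simp [(hcol u).2 hne] at hi
  have hL'o : ∀ {a b}, a ≠ v → b ≠ v → L' s(a, b) = L₁ s(a, b) := by
    intro a b ha hb
    have : v ∉ s(a, b) := by simp [ha.symm, hb.symm]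
    simp [L', this]
  have hkey : ∀ {b d i}, b ∈ S → d ∈ S → d ≠ v → G.Adj v b → G.Adj b d →
      L' s(v, b) = some i → L' s(b, d) = some i → G.Adj v d := by
    intro b d i hb hd hdv hvb hbd h₁ h₂
    rw [hL'v] at h₁
    rw [hL'o hvb.ne' hdv] at h₂
    by_contra hvd
    exact (hcol' hb hvb h₁).2 d (mem_conflicts.2 ⟨hd, hbd, hdv, hvd⟩) h₂
  refine ⟨L', ⟨?_, ?_⟩, ?_⟩
  · intro a ha b hb d hd hab hbd had i h₁ h₂
    by_cases hbv : b = v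
    · subst hbv
      exact hdel.1 a ha d hd hab.symm hbd had
    by_cases hav : a = v
    · subst hav
      exact hkey hb hd had.symm hab hbd h₁ h₂
    by_cases hdv : d = v
    · subst hdv
      rw [Sym2.eq_swap] at h₁ h₂
      exact (hkey hb ha had hbd.symm hab.symm h₂ h₁).symm
    · rw [hL'o hav hbv] at h₁
      rw [hL'o hbv hdv] at h₂
      exact hL₁.1 a (Finset.mem_erase.2 ⟨hav, ha⟩) b (Finset.mem_erase.2 ⟨hbv, hb⟩) d
        (Finset.mem_erase.2 ⟨hdv, hd⟩) hab hbd had i h₁ h₂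
  · have hvcase : ∀ b ∈ S, G.Adj v b → ∀ i, L' s(v, b) = some i → i ∈ Ψ s(v, b) := by
      intro b hb hvb i hi
      rw [hL'v] at hi
      exact (hcol' hb hvb hi).1
    intro a ha b hb hab i hi
    by_cases hav : a = v
    · subst hav
      exact hvcase b hb hab i hi
    by_cases hbv : b = v
    · subst hbv
      rw [Sym2.eq_swap] at hi ⊢
      exact hvcase a ha hab.symm i hi
    · rw [hL'o hav hbv] at hi
      exact hL₁.2 a (Finset.mem_erase.2 ⟨hav, ha⟩) b (Finset.mem_erase.2 ⟨hbv, hb⟩) hab i hi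
  · rw [card_weakSet_erase hv]
    have h₁ : weakSet G (S.erase v) L' = weakSet G (S.erase v) L₁ := by
      ext e
      induction e with | _ a b
      simp only [mk_mem_weakSet, Finset.mem_erase]
      refine and_congr_right fun h => ?_
      rw [hL'o h.1.1 h.2.1]
    rw [h₁, emptyCount]
    refine add_le_add hcard (Finset.card_le_card fun u hu => ?_)
    simp only [Finset.mem_filter] at hu ⊢
    refine ⟨hu.1, hu.2.1, ?_⟩
    have := hu.2.2
    rw [hL'v] at this
    by_contra hne
    obtain ⟨i, _, hi, _⟩ := (hcol u).1 hu.1 hu.2.1 (Finset.nonempty_iff_ne_empty.2 hne)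
    simp [hi] at this

/-- Edges with an empty list are weak in every solution, and an extension needs no other weak edges
at `v`. The strict bound in `YesOn` makes truncated subtraction harmless: an overdrawn budget
becomes `0`, which no labeling meets. -/
theorem yesOn_erase_iff {S : Finset V} {v : V} (hv : v ∈ S) (hdel : Deletable G Ψ S v) (K : ℕ) :
    YesOn G Ψ S K ↔ YesOn G Ψ (S.erase v) (K - emptyCount G Ψ S v) := by
  classical
  constructor
  · rintro ⟨L, hL, hcard⟩
    refine ⟨L, hL.mono (Finset.erase_subset _ _), ?_⟩
    rw [card_weakSet_erase hv] at hcard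
    have : emptyCount G Ψ S v ≤ (S.filter fun u => G.Adj v u ∧ L s(v, u) = none).card := by
      refine Finset.card_le_card fun u hu => ?_
      simp only [Finset.mem_filter] at hu ⊢
      refine ⟨hu.1, hu.2.1, Option.eq_none_iff_forall_ne_some.2 fun i hi => ?_⟩
      have := hL.2 v hv u hu.1 hu.2.1 i hi
      simp [hu.2.2] at this
    omega
  · rintro ⟨L, hL, hcard⟩
    obtain ⟨L', hL', hcard'⟩ := exists_extension hv hdel hL
    exact ⟨L', hL', by omega⟩

theorem card_weakSet_le (S : Finset V) (L : Sym2 V → Option (Fin c)) :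
    (weakSet G S L).card ≤ S.card ^ 2 := by
  classical
  refine (Finset.card_le_card (t := (S ×ˢ S).image fun p => s(p.1, p.2)) fun e he => ?_).trans
    (Finset.card_image_le.trans (by rw [Finset.card_product, sq]))
  induction e with | _ a b
  exact Finset.mem_image.2 ⟨(a, b), by simpa using (mk_mem_weakSet.1 he).1, rfl⟩

/-- A budget above the number of edges is no restriction. This justifies the cap before the sweep,
for the unary counter, and after it, for the size of the kernel. -/
theorem yesOn_min_iff (S : Finset V) (k : ℕ) :
    YesOn G Ψ S (min k (S.card ^ 2) + 1) ↔ YesOn G Ψ S (k + 1) := by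
  refine exists_congr fun L => and_congr_right fun _ => ?_
  have := card_weakSet_le (G := G) S L
  omega

end Deletion

/-! ### The size of the kernel -/

section Size

variable {V : Type*} [Fintype V] {G : SimpleGraph V} {c : ℕ} {Ψ : Sym2 V → Finset (Fin c)}

-- The set `F` stands for the retained vertices. The hypothesis records a failed test in a form
-- independent of the induced subgraph in which it took place: twins of `v`, counted together with
-- `v` itself, are at most as many as the conflicts in all of `G`.
open Classical in
theorem card_retained_le {L₁ : Sym2 V → Option (Fin 1)}
    (hL₁ : Good G (fun _ => Finset.univ) Finset.univ L₁) (lists : Finset (Finset (Fin c)))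
    (F : Finset V)
    (hF : ∀ v ∈ F, (∀ u w, G.Adj v u → G.Adj v w → u ≠ w → G.Adj u w) →
      ∃ u, G.Adj v u ∧ Ψ s(v, u) ∈ lists ∧
        ∀ T ⊆ F, (∀ x ∈ T, (x = v ∨ G.Adj v x ∧ ∀ w, G.Adj x w → w = v ∨ G.Adj v w) ∧
          G.Adj u x ∧ Ψ s(x, u) = Ψ s(v, u)) → T.card ≤ (conflicts G Finset.univ v u).card) :
    F.card ≤ (lists.card + 1) * (2 * (weakSet G Finset.univ L₁).card) := by
  let H : SimpleGraph V :=
    { Adj := fun a b => G.Adj a b ∧ L₁ s(a, b) = none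
      symm := ⟨fun a b h => ⟨h.1.symm, by rw [Sym2.eq_swap]; exact h.2⟩⟩
      loopless := ⟨fun a h => h.1.ne rfl⟩ }
  have hHe : H.edgeFinset = weakSet G Finset.univ L₁ := by
    ext e
    induction e with | _ a b
    rw [mk_mem_weakSet]
    simp [H]
  have hstrong : ∀ {v u}, H.degree v = 0 → G.Adj v u → L₁ s(v, u) = some 0 := by
    intro v u hv hvu
    have : ¬ H.Adj v u := fun h => (H.degree_pos_iff_exists_adj v |>.2 ⟨u, h⟩).ne' hv
    cases h : L₁ s(v, u) with
    | none => exact absurd ⟨hvu, h⟩ this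
    | some i => rw [Subsingleton.elim i 0]
  have hsimp : ∀ {v}, H.degree v = 0 → ∀ u w, G.Adj v u → G.Adj v w → u ≠ w → G.Adj u w := by
    intro v hv u w hvu hvw huw
    refine hL₁.1 u (Finset.mem_univ _) v (Finset.mem_univ _) w (Finset.mem_univ _) hvu.symm hvw
      huw 0 ?_ (hstrong hv hvw)
    rw [Sym2.eq_swap]
    exact hstrong hv hvu
  -- The retained vertices that are isolated in `H`, sorted by the neighbour `u` at which their test
  -- failed and by the list on the edge to `u`.
  let group (u : V) (ψ : Finset (Fin c)) : Finset V :=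
    F.filter fun v => H.degree v = 0 ∧ G.Adj v u ∧ Ψ s(v, u) = ψ ∧
        ∀ T ⊆ F, (∀ x ∈ T, (x = v ∨ G.Adj v x ∧ ∀ w, G.Adj x w → w = v ∨ G.Adj v w) ∧
          G.Adj u x ∧ Ψ s(x, u) = Ψ s(v, u)) → T.card ≤ (conflicts G Finset.univ v u).card
  have hgroup : ∀ u ψ, (group u ψ).card ≤ H.degree u := by
    intro u ψ
    rcases (group u ψ).eq_empty_or_nonempty with h | ⟨v, hv⟩
    · simp [h]
    obtain ⟨hvF, hv0, hvu, hψ, hcard⟩ := Finset.mem_filter.1 hv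
    -- Both `vu` and `xu` are strong in `L₁`, so `v` and `x` are adjacent; as `N(x)` is a clique
    -- containing `v`, it lies in `N[v]`.
    have h₁ : ∀ x ∈ group u ψ, (x = v ∨ G.Adj v x ∧ ∀ w, G.Adj x w → w = v ∨ G.Adj v w) ∧
          G.Adj u x ∧ Ψ s(x, u) = Ψ s(v, u) := by
      intro x hx
      obtain ⟨hxF, hx0, hxu, hxψ, -⟩ := Finset.mem_filter.1 hx
      refine ⟨?_, hxu.symm, hxψ.trans hψ.symm⟩
      by_cases hxv : x = v
      · exact Or.inl hxv
      · have hadj : G.Adj v x := by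
          refine hL₁.1 v (Finset.mem_univ _) u (Finset.mem_univ _) x (Finset.mem_univ _) hvu
            hxu.symm (Ne.symm hxv) 0 (hstrong hv0 hvu) ?_
          rw [Sym2.eq_swap]
          exact hstrong hx0 hxu
        refine Or.inr ⟨hadj, fun w hxw => ?_⟩
        by_cases hwv : w = v
        · exact Or.inl hwv
        · exact Or.inr (hsimp hx0 v w hadj.symm hxw (Ne.symm hwv))
    refine (hcard _ (Finset.filter_subset _ _) h₁).trans ?_
    rw [← SimpleGraph.card_neighborFinset_eq_degree]
    -- Since `vu` is strong and `vw` is no edge, every conflict edge `uw` is weak in `L₁`, that is,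
    -- an edge of `H`.
    refine Finset.card_le_card fun w hw => ?_
    obtain ⟨-, huw, hwv, hvw⟩ := mem_conflicts.1 hw
    rw [SimpleGraph.mem_neighborFinset]
    refine ⟨huw, ?_⟩
    by_contra h
    obtain ⟨i, hi⟩ := Option.ne_none_iff_exists'.1 h
    rw [Subsingleton.elim i 0] at hi
    exact hvw (hL₁.1 v (Finset.mem_univ _) u (Finset.mem_univ _) w (Finset.mem_univ _) hvu huw
      (Ne.symm hwv) 0 (hstrong hv0 hvu) hi)
  have hcover : F ⊆ (Finset.univ.filter fun v => H.degree v ≠ 0) ∪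
      Finset.univ.biUnion fun u => lists.biUnion fun ψ => group u ψ := by
    intro v hv
    by_cases hv0 : H.degree v = 0
    · obtain ⟨u, hvu, hl, hcard⟩ := hF v hv (hsimp hv0)
      refine Finset.mem_union_right _ (Finset.mem_biUnion.2 ⟨u, Finset.mem_univ _,
        Finset.mem_biUnion.2 ⟨_, hl, Finset.mem_filter.2 ⟨hv, hv0, hvu, rfl, hcard⟩⟩⟩)
    · exact Finset.mem_union_left _ (by simpa using hv0)
  have h₁ : (Finset.univ.filter fun v => H.degree v ≠ 0).card ≤ ∑ v, H.degree v := by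
    rw [Finset.card_filter]
    refine Finset.sum_le_sum fun v _ => ?_
    split_ifs <;> omega
  have h₂ : (Finset.univ.biUnion fun u => lists.biUnion fun ψ => group u ψ).card
      ≤ ∑ u, lists.card * H.degree u := by
    refine Finset.card_biUnion_le.trans (Finset.sum_le_sum fun u _ => ?_)
    exact Finset.card_biUnion_le_card_mul _ _ _ fun ψ _ => hgroup u ψ
  rw [← Finset.mul_sum] at h₂
  have h₃ := (Finset.card_le_card hcover).trans (Finset.card_union_le _ _)
  rw [← hHe, ← SimpleGraph.sum_degrees_eq_twice_card_edges]
  linarith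

end Size

/-! ### The reduction on the matrix of an instance -/

section Sweep

variable {V : Type*}

/-- For a vertex retained from `s`, `l'` is the vertex list at the moment of its test. It contains
all vertices of the final list, which is what the counting argument needs, so no vertex has to be
tested twice. -/
theorem sweep_spec (A : V → V → Data) (W : Data) (s l : List V) (K : ℕ) (hsl : (s ++ l).Nodup) :
    (sweep A W s l K).2.Nodup ∧ (sweep A W s l K).2 ⊆ s ++ l ∧
      ∀ v ∈ (sweep A W s l K).2, v ∈ l ∨
        ∃ l', l'.Nodup ∧ (sweep A W s l K).2 ⊆ l' ∧ v ∈ l' ∧ ¬ Removable A W l' v := by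
  induction s generalizing l K with
  | nil => exact ⟨hsl, fun _ h => h, fun v hv => Or.inl hv⟩
  | cons v t ih =>
    rw [sweep]
    split_ifs with hrem
    · obtain ⟨h₁, h₂, h₃⟩ := ih l (K - forcedCount A W (v :: t ++ l) v)
        (List.nodup_cons.1 hsl).2
      exact ⟨h₁, List.Subset.trans h₂ (List.subset_cons_self _ _), h₃⟩
    · have hperm : (t ++ (l ++ [v])).Perm (v :: t ++ l) := by
        rw [← List.append_assoc]
        exact List.perm_append_singleton v (t ++ l)
      obtain ⟨h₁, h₂, h₃⟩ := ih (l ++ [v]) K (hperm.nodup_iff.2 hsl)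
      refine ⟨h₁, List.Subset.trans h₂ hperm.subset, fun x hx => ?_⟩
      rcases h₃ x hx with h | h
      · rcases List.mem_append.1 h with h | h
        · exact Or.inl h
        · obtain rfl := List.mem_singleton.1 h
          exact Or.inr ⟨_, hsl, List.Subset.trans h₂ hperm.subset, by simp, hrem⟩
      · exact Or.inr h

variable [DecidableEq V]

/-- The matrix `A` represents the graph `G` with the lists `Ψ`; the entry `W` stands for an edge
with an empty list. -/
structure Represents {c : ℕ} (A : V → V → Data) (W : Data) (G : SimpleGraph V)
    (Ψ : Sym2 V → Finset (Fin c)) : Prop where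
  ne_nil_iff : ∀ a b, A a b ≠ Data.nil ↔ G.Adj a b
  weak_ne_nil : W ≠ Data.nil
  eq_weak_iff : ∀ a b, G.Adj a b → (A a b = W ↔ Ψ s(a, b) = ∅)
  eq_iff : ∀ a b a' b', G.Adj a b → G.Adj a' b' →
    (A a b = A a' b' ↔ Ψ s(a, b) = Ψ s(a', b'))

theorem length_filter_eq_card {l : List V} (hl : l.Nodup) {P : V → Prop} [DecidablePred P]
    {T : Finset V} (h : ∀ x, x ∈ T ↔ x ∈ l ∧ P x) : (l.filter fun x => P x).length = T.card := by
  rw [← List.toFinset_card_of_nodup (hl.filter _)]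
  congr 1
  ext x
  simp [h]

variable {c : ℕ} {A : V → V → Data} {W : Data} {G : SimpleGraph V} {Ψ : Sym2 V → Finset (Fin c)}

namespace Represents

theorem diffCount_eq (h : Represents A W G Ψ) {l : List V} (hl : l.Nodup) (a b : V) :
    diffCount A l a b = (open Classical in
      l.toFinset.filter fun w => G.Adj a w ∧ ¬ G.Adj b w).card := by
  classical
  refine length_filter_eq_card hl fun x => ?_
  rw [Finset.mem_filter, List.mem_toFinset, h.ne_nil_iff, ← h.ne_nil_iff b, not_not]

/-- There are no loops, so `b` itself is always counted; the value `1` means that no other neighbour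
of `a` is missed by `b`. -/
theorem diffCount_eq_one_iff (h : Represents A W G Ψ) {l : List V} (hl : l.Nodup) {a b : V}
    (hab : G.Adj a b) (hb : b ∈ l) :
    diffCount A l a b = 1 ↔ ∀ w ∈ l, G.Adj a w → w ≠ b → G.Adj b w := by
  classical
  rw [h.diffCount_eq hl, Finset.card_eq_one]
  constructor
  · rintro ⟨x, hx⟩ w hw haw hwb
    have hbx : b ∈ ({x} : Finset V) := by rw [← hx]; simp [hb, hab]
    by_contra hbw
    have hwx : w ∈ ({x} : Finset V) := by rw [← hx]; simp [hw, haw, hbw]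
    rw [Finset.mem_singleton] at hbx hwx
    exact hwb (hwx.trans hbx.symm)
  · intro hw
    refine ⟨b, ?_⟩
    ext w
    simp only [Finset.mem_filter, List.mem_toFinset, Finset.mem_singleton]
    constructor
    · rintro ⟨h₁, h₂, h₃⟩
      by_contra hwb
      exact h₃ (hw w h₁ h₂ hwb)
    · rintro rfl
      exact ⟨hb, hab, G.loopless.irrefl _⟩

/-- The extra one is `v`, a neighbour of `u` but not of itself. It cancels against the `+ 1` in
`Removable`. -/
theorem diffCount_eq_conflicts (h : Represents A W G Ψ) {l : List V} (hl : l.Nodup) {v u : V}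
    (hv : v ∈ l) (hvu : G.Adj v u) :
    diffCount A l u v = (conflicts G l.toFinset v u).card + 1 := by
  classical
  rw [h.diffCount_eq hl, ← Finset.card_insert_of_notMem (a := v) (by simp [mem_conflicts])]
  congr 1
  ext w
  simp only [Finset.mem_filter, List.mem_toFinset, Finset.mem_insert, mem_conflicts]
  constructor
  · rintro ⟨h₁, h₂, h₃⟩
    by_cases hwv : w = v
    · exact Or.inl hwv
    · exact Or.inr ⟨h₁, h₂, hwv, h₃⟩
  · rintro (rfl | ⟨h₁, h₂, _, h₃⟩)
    · exact ⟨hv, hvu.symm, G.loopless.irrefl _⟩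
    · exact ⟨h₁, h₂, h₃⟩

open Classical in
theorem length_twins (h : Represents A W G Ψ) {l : List V} (hl : l.Nodup) {v u : V}
    (hv : v ∈ l) (hvu : G.Adj v u) :
    (l.filter fun x => A v x ≠ Data.nil ∧ diffCount A l x v = 1 ∧ A u x = A v u).length
      = (twins G Ψ l.toFinset v u).card := by
  refine length_filter_eq_card hl fun x => ?_
  rw [h.ne_nil_iff, mem_twins, List.mem_toFinset]
  refine and_congr_right fun _ => and_congr_right fun hvx => (and_congr ?_ ?_).symm
  · rw [h.diffCount_eq_one_iff hl hvx.symm hv]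
    simp only [List.mem_toFinset]
    refine forall₃_congr fun w _ _ => ?_
    tauto
  · constructor
    · intro he
      have hux : G.Adj u x := by
        rw [← h.ne_nil_iff, he, h.ne_nil_iff]; exact hvu
      exact ⟨hux, by rw [Sym2.eq_swap (a := x), ← h.eq_iff _ _ _ _ hux hvu]; exact he⟩
    · rintro ⟨hux, he⟩
      rw [h.eq_iff _ _ _ _ hux hvu, ← he, Sym2.eq_swap]

theorem removable_iff (h : Represents A W G Ψ) {l : List V} (hl : l.Nodup) {v : V}
    (hv : v ∈ l) : Removable A W l v ↔ Deletable G Ψ l.toFinset v := by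
  classical
  have hrem : Removable A W l v ↔ ∀ u ∈ l, G.Adj v u →
      (∀ w ∈ l, G.Adj v w → w ≠ u → G.Adj u w) ∧ (Ψ s(v, u) = ∅ ∨
        (conflicts G l.toFinset v u).card ≤ (twins G Ψ l.toFinset v u).card) := by
    refine forall₂_congr fun u hu => ?_
    rw [h.ne_nil_iff]
    refine forall_congr' fun hvu => ?_
    rw [h.diffCount_eq_one_iff hl hvu hu, h.eq_weak_iff _ _ hvu,
      h.diffCount_eq_conflicts hl hv hvu, h.length_twins hl hv hvu, Nat.add_le_add_iff_right]
  rw [hrem, Deletable]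
  simp only [List.mem_toFinset]
  constructor
  · intro H
    exact ⟨fun u hu w hw hvu hvw huw => (H u hu hvu).1 w hw hvw huw.symm,
      fun u hu hvu => (H u hu hvu).2⟩
  · rintro ⟨H₁, H₂⟩ u hu hvu
    exact ⟨fun w hw hvw hwu => H₁ u hu w hw hvu hvw hwu.symm, H₂ u hu hvu⟩

theorem forcedCount_eq (h : Represents A W G Ψ) {l : List V} (hl : l.Nodup) (v : V) :
    forcedCount A W l v = emptyCount G Ψ l.toFinset v := by
  classical
  refine length_filter_eq_card hl fun u => ?_
  rw [Finset.mem_filter, List.mem_toFinset]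
  refine and_congr_right fun _ => Iff.symm ?_
  constructor
  · intro hu
    have hvu : G.Adj v u := by rw [← h.ne_nil_iff, hu]; exact h.weak_ne_nil
    exact ⟨hvu, (h.eq_weak_iff _ _ hvu).1 hu⟩
  · rintro ⟨hvu, hu⟩
    exact (h.eq_weak_iff _ _ hvu).2 hu

theorem yesOn_sweep_iff (h : Represents A W G Ψ) (s l : List V) (K : ℕ) (hsl : (s ++ l).Nodup) :
    YesOn G Ψ (sweep A W s l K).2.toFinset (sweep A W s l K).1 ↔
      YesOn G Ψ (s ++ l).toFinset K := by
  induction s generalizing l K with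
  | nil => simp [sweep]
  | cons v t ih =>
    rw [sweep]
    split_ifs with hrem
    · rw [List.cons_append, List.nodup_cons] at hsl
      have hdel := (h.removable_iff (l := v :: t ++ l) (by simpa using hsl) (by simp)).1 hrem
      rw [ih _ _ hsl.2, yesOn_erase_iff (S := (v :: t ++ l).toFinset) (by simp) hdel,
        h.forcedCount_eq (by simpa using hsl)]
      have : (v :: t ++ l).toFinset.erase v = (t ++ l).toFinset := by
        rw [List.cons_append, List.toFinset_cons, Finset.erase_insert (by simpa using hsl.1)]
      rw [this]
    · have hperm : (t ++ (l ++ [v])).Perm (v :: t ++ l) := by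
        rw [← List.append_assoc]
        exact List.perm_append_singleton v (t ++ l)
      rw [ih _ _ (hperm.nodup_iff.2 hsl), List.toFinset_eq_of_perm _ _ hperm]

end Represents

/-- This feeds `card_retained_le` with the failed tests. A clique neighbourhood in `G` is one in
every induced subgraph, so for such a vertex the test can only fail through too few twins. -/
theorem Represents.length_sweep_le [Fintype V] (h : Represents A W G Ψ)
    {L₁ : Sym2 V → Option (Fin 1)} (hL₁ : Good G (fun _ => Finset.univ) Finset.univ L₁)
    (lists : Finset (Finset (Fin c)))
    (hlists : ∀ a b, G.Adj a b → Ψ s(a, b) ≠ ∅ → Ψ s(a, b) ∈ lists) {s : List V} (hs : s.Nodup)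
    (K : ℕ) : (sweep A W s [] K).2.length
      ≤ (lists.card + 1) * (2 * (weakSet G Finset.univ L₁).card) := by
  classical
  obtain ⟨hnodup, -, hspec⟩ := sweep_spec A W s [] K (by simpa using hs)
  rw [← List.toFinset_card_of_nodup hnodup]
  refine card_retained_le hL₁ (Ψ := Ψ) lists _ fun v hv hsimp => ?_
  rw [List.mem_toFinset] at hv
  obtain ⟨l, hl, hsub, hvl, hrem⟩ := (hspec v hv).resolve_left (by simp)
  rw [h.removable_iff hl hvl, Deletable, not_and] at hrem
  have := hrem fun u _ w _ hvu hvw huw => hsimp u w hvu hvw huw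
  push Not at this
  obtain ⟨u, -, hvu, hne, hcard⟩ := this
  refine ⟨u, hvu, hlists _ _ hvu hne.ne_empty, ?_⟩
  intro T hT hT'
  -- The set `T` consists of retained vertices, hence lies in the list `l` of the test, and `N(x) ⊆
  -- N[v]` in `G` passes to `l`. Including `v` costs one, which the strict inequality of the failed
  -- test pays for.
  have h₁ : T ⊆ insert v (twins G Ψ l.toFinset v u) := by
    intro x hx
    obtain ⟨hx', hux, he⟩ := hT' x hx
    rcases hx' with rfl | ⟨hvx, hx'⟩
    · exact Finset.mem_insert_self _ _
    · exact Finset.mem_insert_of_mem (mem_twins.2 ⟨List.mem_toFinset.2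
        (hsub (List.mem_toFinset.1 (hT hx))), hvx, fun w _ => hx' w, hux, he⟩)
  refine (Finset.card_le_card h₁).trans ((Finset.card_insert_le _ _).trans ((Nat.succ_le_of_lt hcard).trans ?_))
  refine Finset.card_le_card fun w hw => ?_
  rw [mem_conflicts] at hw ⊢
  exact ⟨Finset.mem_univ _, hw.2⟩

end Sweep

/-! ### Labelings of graphs and of induced subgraphs -/

section Transfer

variable {V V' : Type*} {G : SimpleGraph V} {G' : SimpleGraph V'}
  {c : ℕ} {g : V' → V} {Ψ : Sym2 V → Finset (Fin c)}

theorem good_iff [Fintype V'] [DecidableEq V] (hG : ∀ a b, G'.Adj a b ↔ G.Adj (g a) (g b)) (hg : Function.Injective g)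
    {Ψ' : G'.edgeSet → Finset (Fin c)} (hΨ : ∀ e, Ψ' e = Ψ (e.1.map g))
    {L : Labeling G' c} {L₁ : Sym2 V → Option (Fin c)} (hL : ∀ e, L e = L₁ (e.1.map g)) :
    Good G Ψ (Finset.univ.image g) L₁ ↔ L.IsSTC ∧ L.Satisfies Ψ' := by
  simp only [Good, Finset.forall_mem_image, Finset.mem_univ, true_imp_iff, Labeling.IsSTC,
    Labeling.Satisfies, hL, hΨ, Sym2.map_mk]
  refine and_congr ?_ ?_
  · constructor
    · intro h u v w huv hvw i huw h₁ h₂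
      exact (hG _ _).2 (h ((hG _ _).1 huv) ((hG _ _).1 hvw) (hg.ne huw) i h₁ h₂)
    · intro h u v w huv hvw huw i h₁ h₂
      exact (hG _ _).1 (h u v w ((hG _ _).2 huv) ((hG _ _).2 hvw) i
        (fun h' => huw (congrArg g h')) h₁ h₂)
  · constructor
    · rintro h ⟨e, he⟩ i hi
      induction e with | _ a b
      exact h ((hG _ _).1 he) i hi
    · intro h a b hab i hi
      exact h ⟨s(a, b), (hG _ _).2 hab⟩ i hi

theorem card_weakSet_image [Fintype V'] [DecidableEq V] (hG : ∀ a b, G'.Adj a b ↔ G.Adj (g a) (g b))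
    (hg : Function.Injective g) {L : Labeling G' c} {L₁ : Sym2 V → Option (Fin c)}
    (hL : ∀ e, L e = L₁ (e.1.map g)) :
    (weakSet G (Finset.univ.image g) L₁).card = L.weakCount := by
  have hinj : Function.Injective fun e : G'.edgeSet => e.1.map g :=
    fun a b h => Subtype.ext (Sym2.map.injective hg h)
  rw [Labeling.weakCount, ← Set.ncard_image_of_injective _ hinj, ← Set.ncard_coe_finset]
  congr 1
  ext e
  simp only [Finset.mem_coe, Set.mem_image, Set.mem_ofPred_eq]
  constructor
  · intro he
    induction e with | _ a b
    obtain ⟨⟨ha, hb⟩, hab, he⟩ := mk_mem_weakSet.1 he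
    obtain ⟨a, _, rfl⟩ := Finset.mem_image.1 ha
    obtain ⟨b, _, rfl⟩ := Finset.mem_image.1 hb
    exact ⟨⟨s(a, b), (hG _ _).2 hab⟩, by rw [hL]; exact he, rfl⟩
  · rintro ⟨⟨e, he⟩, hw, rfl⟩
    induction e with | _ a b
    rw [hL] at hw
    exact mk_mem_weakSet.2 ⟨⟨Finset.mem_image_of_mem _ (Finset.mem_univ _),
      Finset.mem_image_of_mem _ (Finset.mem_univ _)⟩, (hG _ _).1 he, hw⟩

theorem exists_extend (hg : Function.Injective g) (L : Labeling G' c) :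
    ∃ L₁ : Sym2 V → Option (Fin c), ∀ e, L e = L₁ (e.1.map g) := by
  have hinj : Function.Injective fun e : G'.edgeSet => e.1.map g :=
    fun a b h => Subtype.ext (Sym2.map.injective hg h)
  exact ⟨Function.extend _ L fun _ => none, fun e => (hinj.extend_apply L _ e).symm⟩

/-- The map `g` is the identity for the given instance and `l.get` for the kernel, so that both are
questions about vertex sets of one graph `G`. -/
theorem exists_labeling_iff [Fintype V'] [DecidableEq V] (hG : ∀ a b, G'.Adj a b ↔ G.Adj (g a) (g b))
    (hg : Function.Injective g) {Ψ' : G'.edgeSet → Finset (Fin c)}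
    (hΨ : ∀ e, Ψ' e = Ψ (e.1.map g)) (k : ℕ) :
    (∃ L : Labeling G' c, L.IsSTC ∧ L.Satisfies Ψ' ∧ L.weakCount ≤ k) ↔
      YesOn G Ψ (Finset.univ.image g) (k + 1) := by
  constructor
  · rintro ⟨L, h₁, h₂, h₃⟩
    obtain ⟨L₁, hL⟩ := exists_extend hg L
    exact ⟨L₁, (good_iff hG hg hΨ hL).2 ⟨h₁, h₂⟩,
      by rw [card_weakSet_image hG hg hL]; omega⟩
  · rintro ⟨L₁, h₁, h₂⟩
    have hL : ∀ e : G'.edgeSet, (fun e => L₁ (e.1.map g) : Labeling G' c) e = L₁ (e.1.map g) :=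
      fun _ => rfl
    obtain ⟨h₃, h₄⟩ := (good_iff hG hg hΨ hL).1 h₁
    rw [card_weakSet_image hG hg hL] at h₂
    exact ⟨_, h₃, h₄, by omega⟩

theorem exists_good_one (G' : SimpleGraph V') :
    ∃ L : Labeling G' 1, L.IsSTC ∧ L.weakCount = k₁ G' := by
  refine Nat.sInf_mem (s := {m | ∃ L : Labeling G' 1, L.IsSTC ∧ L.weakCount = m})
    ⟨_, fun _ => none, ?_, rfl⟩
  intro u v w _ _ i _ h
  simp at h

theorem exists_good_card_eq_k₁ [Fintype V'] [DecidableEq V'] (G' : SimpleGraph V') :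
    ∃ L₁ : Sym2 V' → Option (Fin 1), Good G' (fun _ => Finset.univ) Finset.univ L₁ ∧
      (weakSet G' Finset.univ L₁).card = k₁ G' := by
  obtain ⟨L, hL, hk⟩ := exists_good_one G'
  obtain ⟨L₁, h⟩ := exists_extend Function.injective_id L
  have h₁ := (good_iff (G := G') (Ψ := fun _ => Finset.univ) (Ψ' := fun _ => Finset.univ)
    (fun _ _ => Iff.rfl) Function.injective_id (fun _ => rfl) h).2 ⟨hL, fun _ _ _ => Finset.mem_univ _⟩
  have h₂ := card_weakSet_image (G := G') (fun _ _ => Iff.rfl) Function.injective_id h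
  simp only [Finset.image_id']  at h₁ h₂
  exact ⟨L₁, h₁, h₂.trans hk⟩

theorem weakCount_le [Fintype V'] (G' : SimpleGraph V') (L : Labeling G' c) :
    L.weakCount ≤ Fintype.card V' ^ 2 := by
  classical
  obtain ⟨L₁, hL⟩ := exists_extend Function.injective_id L
  rw [← card_weakSet_image (G := G') (fun _ _ => Iff.rfl) Function.injective_id hL]
  refine (card_weakSet_le _ _).trans ?_
  simp only [Finset.image_id', Finset.card_univ, le_refl]

theorem k₁_le [Fintype V'] (G' : SimpleGraph V') : k₁ G' ≤ Fintype.card V' ^ 2 := by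
  obtain ⟨L, _, hk⟩ := exists_good_one G'
  exact hk ▸ weakCount_le G' L

end Transfer

/-! ### Kernelization of EL-Multi-STC -/

theorem Data.unary_eq_nil_iff {n : ℕ} : Data.unary n = Data.nil ↔ n = 0 := by
  cases n <;> simp [Data.unary, List.replicate_succ]

theorem Data.size_ofNat_le (n : ℕ) : (Data.ofNat n).size ≤ 4 * n + 1 := by
  induction n with
  | zero => simp [Data.ofNat]
  | succ n ih =>
    have := (Data.ofNat n).size_inc_le
    rw [Data.inc_ofNat] at this
    omega

theorem Data.size_ofList_le {l : List Data} {m s : ℕ} (hl : l.length ≤ m)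
    (hs : ∀ d ∈ l, d.size ≤ s) : (Data.ofList l).size ≤ m * (s + 1) + 1 := by
  rw [Data.size_ofList]
  have := List.sum_le_card_nsmul (l.map fun d => d.size + 1) (s + 1) (by simpa using hs)
  rw [List.length_map, smul_eq_mul] at this
  exact Nat.add_le_add_right (this.trans (Nat.mul_le_mul_right _ hl)) 1

theorem size_encodeMatrix_le {n s : ℕ} {A : Fin n → Fin n → Data}
    (hA : ∀ i j, (A i j).size ≤ s) : (encodeMatrix A).size ≤ n * (n * (s + 1) + 1 + 1) + 1 := by
  refine Data.size_ofList_le (by simp) fun d hd => ?_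
  obtain ⟨i, rfl⟩ := (List.mem_ofFn' _ _).1 hd
  refine Data.size_ofList_le (by simp) fun d hd => ?_
  obtain ⟨j, rfl⟩ := (List.mem_ofFn' _ _).1 hd
  exact hA i j

theorem size_encodeColors_le {c : ℕ} (s : Finset (Fin c)) :
    (encodeColors s).size ≤ c * (4 * c + 1 + 1) + 1 := by
  refine Data.size_ofList_le ?_ fun d hd => ?_
  · rw [List.length_map, Finset.length_sort]
    exact card_finset_fin_le s
  · obtain ⟨i, _, rfl⟩ := List.mem_map.1 hd
    have := Data.size_ofNat_le i.val
    omega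

theorem encodeColors_injective {c : ℕ} :
    Function.Injective (encodeColors : Finset (Fin c) → Data) := by
  intro s t h
  have h' := List.map_injective_iff.2 (fun (a b : Fin c) hab => Fin.ext (Data.ofNat_injective hab))
    (Data.ofList_injective h)
  rw [← s.sort_toFinset (· ≤ ·), h', Finset.sort_toFinset]

theorem encodeMatrix_get {V : Type*} (A : V → V → Data) (l : List V) :
    encodeMatrix (fun i j => A (l.get i) (l.get j)) = mat A l := by
  have h : ∀ f : V → Data, List.ofFn (fun i => f (l.get i)) = l.map f := by
    intro f
    conv_rhs => rw [← List.ofFn_get l, List.map_ofFn]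
    rfl
  rw [encodeMatrix, mat, ← h]
  simp only [h]

theorem encodeMatrix_eq {n : ℕ} (A : Fin n → Fin n → Data) :
    encodeMatrix A = mat A (List.finRange n) := by
  rw [encodeMatrix, mat, List.ofFn_eq_map]
  simp only [List.ofFn_eq_map]

theorem image_get_univ {V : Type*} [DecidableEq V] (l : List V) :
    Finset.univ.image l.get = l.toFinset := by
  ext x
  simp [List.mem_iff_get]

namespace ELInstance

variable (I : ELInstance)

open Classical in
/-- The edge lists, as a function on all pairs of vertices. -/
noncomputable def lists (e : Sym2 (Fin I.n)) : Finset (Fin I.c) :=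
  if h : e ∈ I.G.edgeSet then I.Ψ ⟨e, h⟩ else ∅

open Classical in
/-- The entries of the matrix that encodes the graph and the lists. -/
noncomputable def entry (i j : Fin I.n) : Data :=
  if I.G.Adj i j then Data.cons Data.nil (encodeColors (I.lists s(i, j))) else Data.nil

/-- The instance on the subgraph induced by a list of vertices. -/
noncomputable def restrict (l : List (Fin I.n)) (k : ℕ) : ELInstance where
  n := l.length
  G := I.G.comap l.get
  c := I.c
  k := k
  Ψ e := I.lists (e.1.map l.get)

/-- A No-instance. -/
def edge (c : ℕ) : ELInstance where
  n := 2
  G := ⊤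
  c := c
  k := 0
  Ψ _ := ∅

/-- The result of the reduction. -/
noncomputable def state : ℕ × List (Fin I.n) :=
  sweep I.entry (Data.cons Data.nil Data.nil) (List.finRange I.n) [] (min I.k (I.n ^ 2) + 1)

/-- The kernel. -/
noncomputable def kernel : ELInstance :=
  if I.state.1 = 0 then edge I.c
  else I.restrict I.state.2 (min (I.state.1 - 1) (I.state.2.length ^ 2))

theorem lists_mk (e : I.G.edgeSet) : I.lists e = I.Ψ e := dif_pos e.2

theorem encode_eq : I.encode = Data.cons (Data.ofNat I.c) (Data.cons (Data.ofNat I.k)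
    (mat I.entry (List.finRange I.n))) := by
  rw [encode, ← encodeMatrix_eq]
  congr 3
  funext i j
  by_cases h : I.G.Adj i j
  · rw [dif_pos h, entry, if_pos h, I.lists_mk ⟨s(i, j), h⟩]
  · rw [dif_neg h, entry, if_neg h]

theorem encode_restrict (l : List (Fin I.n)) (k : ℕ) : (I.restrict l k).encode =
    Data.cons (Data.ofNat I.c) (Data.cons (Data.ofNat k) (mat I.entry l)) := by
  rw [encode, ← encodeMatrix_get]
  refine congrArg (fun d => Data.cons (Data.ofNat I.c) (Data.cons (Data.ofNat k) d))
    (congrArg encodeMatrix (funext fun i => funext fun j => ?_))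
  by_cases h : I.G.Adj (l.get i) (l.get j)
  · rw [entry, if_pos h]
    exact dif_pos (c := (I.restrict l k).G.Adj i j) h
  · rw [entry, if_neg h]
    exact dif_neg (c := (I.restrict l k).G.Adj i j) h

theorem encode_edge (c : ℕ) : (edge c).encode =
    Data.cons (Data.ofNat c) (Data.cons Data.nil Data.edgeMatrix) := by
  have h : encodeColors (∅ : Finset (Fin c)) = Data.nil := by simp [encodeColors]
  simp [encode, edge, encodeMatrix, Data.edgeMatrix, Data.ofNat, h, List.ofFn_succ]

theorem kernelEL_encode : Data.kernelEL I.encode = I.kernel.encode := by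
  have hred := reduce_mat (A := I.entry) (W := Data.cons Data.nil Data.nil) I.k
    (List.finRange I.n)
  rw [List.length_finRange, ← state] at hred
  have hred' : Data.reduce (Data.cons Data.nil Data.nil) I.encode.tail.head I.encode.tail.tail
      = Data.cons (Data.unary I.state.1) (mat I.entry I.state.2) := by
    rw [I.encode_eq]
    exact hred
  by_cases h : I.state.1 = 0
  · rw [Data.kernelEL, if_pos (by rw [hred', h]; rfl), kernel, if_pos h, encode_edge, I.encode_eq]
    rfl
  · rw [Data.kernelEL, if_neg (by rwa [hred', Data.head_cons, Data.unary_eq_nil_iff]), hred',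
      budget_mat, kernel, if_neg h, encode_restrict, I.encode_eq]
    rfl

/-- The empty list of colours is encoded by `nil`, so the entry of an edge equals `cons nil nil`
exactly when its list is empty. -/
theorem represents : Represents I.entry (Data.cons Data.nil Data.nil) I.G I.lists where
  ne_nil_iff a b := by by_cases h : I.G.Adj a b <;> simp [entry, h]
  weak_ne_nil := by simp
  eq_weak_iff a b h := by
    have h' : encodeColors (∅ : Finset (Fin I.c)) = Data.nil := by simp [encodeColors]
    rw [entry, if_pos h, Data.cons.injEq]
    simp only [true_and]
    rw [← h', encodeColors_injective.eq_iff]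
  eq_iff a b a' b' h h' := by
    rw [entry, if_pos h, entry, if_pos h', Data.cons.injEq, encodeColors_injective.eq_iff]
    simp

theorem yes_iff : I.Yes ↔ YesOn I.G I.lists Finset.univ (I.k + 1) := by
  have := exists_labeling_iff (G' := I.G) (Ψ := I.lists) (Ψ' := I.Ψ) (fun _ _ => Iff.rfl)
    Function.injective_id (fun e => by
      change I.Ψ e = I.lists (Sym2.map id e.1)
      rw [Sym2.map_id]
      exact (I.lists_mk e).symm) I.k
  rw [Yes, this]
  simp only [Finset.image_id']

theorem yes_restrict_iff {l : List (Fin I.n)} (hl : l.Nodup) (k : ℕ) :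
    (I.restrict l k).Yes ↔ YesOn I.G I.lists l.toFinset (k + 1) := by
  rw [← image_get_univ]
  exact exists_labeling_iff (G := I.G) (G' := (I.restrict l k).G) (Ψ := I.lists)
    (Ψ' := (I.restrict l k).Ψ) (g := l.get) (fun _ _ => Iff.rfl) hl.injective_get
    (fun _ => rfl) k

theorem not_yes_edge (c : ℕ) : ¬ (edge c).Yes := by
  rintro ⟨L, -, h₁, h₂⟩
  have hadj : (edge c).G.Adj (0 : Fin 2) (1 : Fin 2) := by simp [edge]
  have hL : L ⟨s((0 : Fin 2), (1 : Fin 2)), hadj⟩ = none :=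
    Option.eq_none_iff_forall_ne_some.2 fun i hi =>
      Finset.notMem_empty i (h₁ _ i hi)
  have h₃ : {e | L e = none}.ncard = 0 := Nat.le_zero.1 h₂
  rw [Set.ncard_eq_zero] at h₃
  exact (Set.eq_empty_iff_forall_notMem.1 h₃) _ hL

theorem nodup_state : I.state.2.Nodup :=
  (sweep_spec _ _ _ [] _ (by simpa using List.nodup_finRange I.n)).1

theorem yes_iff_state : I.Yes ↔ YesOn I.G I.lists I.state.2.toFinset I.state.1 := by
  rw [state, I.represents.yesOn_sweep_iff _ _ _ (by simpa using List.nodup_finRange I.n),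
    List.append_nil, List.toFinset_finRange, yes_iff, ← yesOn_min_iff]
  simp

theorem yes_kernel_iff : I.kernel.Yes ↔ I.Yes := by
  rw [I.yes_iff_state, kernel]
  split_ifs with h
  · refine iff_of_false (not_yes_edge _) ?_
    rintro ⟨L, -, hL⟩
    omega
  · rw [yes_restrict_iff _ I.nodup_state, ← List.toFinset_card_of_nodup I.nodup_state,
      yesOn_min_iff, Nat.sub_add_cancel (Nat.one_le_iff_ne_zero.2 h)]

theorem length_state_le : I.state.2.length ≤ (I.τ + 1) * (2 * k₁ I.G) := by
  obtain ⟨L₁, hL₁, hk⟩ := exists_good_card_eq_k₁ I.G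
  have hfin : (Set.range I.Ψ \ {∅}).Finite := Set.toFinite _
  have := I.represents.length_sweep_le hL₁ hfin.toFinset (fun a b hab hne => by
    rw [I.lists_mk ⟨s(a, b), hab⟩] at hne ⊢
    simpa using hne) (List.nodup_finRange I.n) (min I.k (I.n ^ 2) + 1)
  rwa [hk, ← Set.ncard_eq_toFinset_card _ hfin] at this

theorem n_kernel_le : I.kernel.n ≤ (I.τ + 1) * (2 * k₁ I.G) ∨
    (k₁ I.G = 0 ∧ ¬ I.Yes ∧ I.kernel.n ≤ 2) := by
  by_cases h : I.state.1 = 0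
  · have hn : I.kernel.n = 2 := by rw [kernel, if_pos h]; rfl
    -- The two vertices of the fixed No-instance fit into the bound as soon as `k₁` is positive;
    -- otherwise the instance is degenerate.
    rcases Nat.eq_zero_or_pos (k₁ I.G) with hk | hk
    · refine Or.inr ⟨hk, ?_, hn.le⟩
      rw [← yes_kernel_iff, kernel, if_pos h]
      exact not_yes_edge _
    · left
      rw [hn]
      nlinarith
  · left
    rw [kernel, if_neg h]
    exact I.length_state_le

/-- The lists counted are nonempty subsets of a set of `c` colours, of which there are `2 ^ c - 1`.
-/
theorem τ_lt : I.τ + 1 ≤ 2 ^ I.c := by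
  classical
  have h : I.τ ≤ ((Finset.univ : Finset (Finset (Fin I.c))).erase ∅).card := by
    rw [← Set.ncard_coe_finset]
    exact Set.ncard_le_ncard (fun s hs => by simpa using hs.2) (Set.toFinite _)
  rw [Finset.card_erase_of_mem (Finset.mem_univ _), Finset.card_univ, Fintype.card_finset,
    Fintype.card_fin] at h
  have := Nat.one_le_two_pow (n := I.c)
  omega

theorem n_kernel_le_two_pow : I.kernel.n ≤ 2 ^ (I.c + 1) * k₁ I.G ∨
    (k₁ I.G = 0 ∧ ¬ I.Yes ∧ I.kernel.n ≤ 2) := by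
  refine I.n_kernel_le.imp_left fun h => h.trans ?_
  rw [pow_succ, mul_assoc]
  exact Nat.mul_le_mul_right _ I.τ_lt

theorem k_kernel_le : I.kernel.k ≤ I.kernel.n ^ 2 := by
  rw [kernel]
  split_ifs
  · simp [edge]
  · exact min_le_right _ _

theorem c_kernel : I.kernel.c = I.c := by
  rw [kernel]
  split_ifs <;> rfl

theorem size_encode_le : I.encode.size ≤ (4 * I.c + 1) + ((4 * I.k + 1) +
    (I.n * (I.n * (I.c * (4 * I.c + 1 + 1) + 1 + 2 + 1) + 1 + 1) + 1) + 1) + 1 := by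
  rw [encode, Data.size_cons, Data.size_cons]
  gcongr
  · exact Data.size_ofNat_le _
  · exact Data.size_ofNat_le _
  · refine size_encodeMatrix_le fun i j => ?_
    split_ifs with h
    · have := size_encodeColors_le (I.Ψ ⟨s(i, j), h⟩)
      simp only [Data.size_cons, Data.size_nil]
      omega
    · simp

/-- A bound on the number of vertices of the kernel. -/
def vertexBound (p : ℕ) : ℕ := 2 ^ (p + 1) * p + 2

/-- A bound on the size and the parameter of the kernel. -/
def sizeBound (p : ℕ) : ℕ :=
  (4 * p + 1) + ((4 * vertexBound p ^ 2 + 1) + (vertexBound p * (vertexBound p *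
    (p * (4 * p + 1 + 1) + 1 + 2 + 1) + 1 + 1) + 1) + 1) + 1 + (p + vertexBound p ^ 2)

theorem n_kernel_le_vertexBound : I.kernel.n ≤ vertexBound (I.c + k₁ I.G) := by
  rw [vertexBound]
  rcases I.n_kernel_le_two_pow with h | h
  -- Both `c` and `k₁` are at most their sum, and the bound is monotone in each; the summand `2` is
  -- reserved for degenerate instances.
  · refine h.trans (Nat.le_add_right_of_le ?_)
    gcongr
    · norm_num
    · omega
    · omega
  · exact Nat.le_add_left_of_le h.2.2

theorem size_kernel_le : I.kernel.encode.size + (I.kernel.c + k₁ I.kernel.G)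
    ≤ sizeBound (I.c + k₁ I.G) := by
  have hn := I.n_kernel_le_vertexBound
  have hc : I.kernel.c ≤ I.c + k₁ I.G := by rw [c_kernel]; omega
  have hk := I.k_kernel_le.trans (Nat.pow_le_pow_left hn 2)
  have hk₁ : k₁ I.kernel.G ≤ vertexBound (I.c + k₁ I.G) ^ 2 := by
    refine (k₁_le _).trans ?_
    rw [Fintype.card_fin]
    exact Nat.pow_le_pow_left hn 2
  refine (Nat.add_le_add_right I.kernel.size_encode_le _).trans ?_
  rw [sizeBound]
  gcongr

end ELInstance

theorem primrec_two_pow : Primrec fun n : ℕ => 2 ^ n := by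
  have h : Primrec (Nat.rec 1 fun _ m => m + m : ℕ → ℕ) :=
    Primrec.nat_rec₁ 1 (Primrec.nat_add.comp Primrec.snd Primrec.snd)
  refine h.of_eq fun n => ?_
  induction n with
  | zero => rfl
  | succ n ih => rw [pow_succ, ← ih]; exact (mul_two _).symm

theorem ELInstance.primrec_sizeBound : Primrec ELInstance.sizeBound := by
  have add {f g : ℕ → ℕ} (hf : Primrec f) (hg : Primrec g) : Primrec fun n => f n + g n :=
    Primrec.nat_add.comp hf hg
  have mul {f g : ℕ → ℕ} (hf : Primrec f) (hg : Primrec g) : Primrec fun n => f n * g n :=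
    Primrec.nat_mul.comp hf hg
  have const (m : ℕ) : Primrec fun _ : ℕ => m := Primrec.const m
  have id : Primrec fun n : ℕ => n := Primrec.id
  have hv : Primrec vertexBound :=
    add (mul (primrec_two_pow.comp (add id (const 1))) id) (const 2)
  have hv₂ : Primrec fun p => vertexBound p ^ 2 := (mul hv hv).of_eq fun n => (sq _).symm
  have h₄ : Primrec fun p : ℕ => 4 * p := mul (const 4) id
  exact add (add (add (add h₄ (const 1)) (add (add (add (mul (const 4) hv₂) (const 1))
    (add (mul hv (add (add (mul hv (add (add (add (mul id (add (add h₄ (const 1)) (const 1)))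
      (const 1)) (const 2)) (const 1))) (const 1)) (const 1))) (const 1))) (const 1))) (const 1))
    (add id hv₂)

theorem isKernelization_elKernel : IsKernelization ELMultiSTC ELInstance.kernel :=
  ⟨PT.kernelEL.polyTimeComputable ELInstance.kernelEL_encode, ELInstance.yes_kernel_iff,
    ELInstance.sizeBound, ELInstance.primrec_sizeBound.to_comp, ELInstance.size_kernel_le⟩

/-! ### Kernelization of Multi-STC -/

/-- With at least `n ^ 2` colours every edge can have its own, so no edge need be weak. In Multi-STC
the number of colours is not part of the parameter, and this cap bounds it in the kernel. -/
theorem exists_labeling_min_iff {n : ℕ} (G : SimpleGraph (Fin n)) (c k : ℕ) :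
    (∃ L : Labeling G (min c (n ^ 2)), L.IsSTC ∧ L.weakCount ≤ k) ↔
      ∃ L : Labeling G c, L.IsSTC ∧ L.weakCount ≤ k := by
  rcases le_total c (n ^ 2) with h | h
  · rw [min_eq_left h]
  · have key : ∀ m, n ^ 2 ≤ m → ∃ L : Labeling G m, L.IsSTC ∧ L.weakCount ≤ k := by
      classical
      intro m hm
      have hcard : Fintype.card G.edgeSet ≤ Fintype.card (Fin m) := by
        have := weakCount_le G (fun _ => none : Labeling G 0)
        simp only [Labeling.weakCount] at this
        rw [Fintype.card_fin] at this ⊢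
        rw [← Nat.card_eq_fintype_card, ← Set.ncard_univ]
        refine le_trans (le_of_eq ?_) (this.trans hm)
        simp
      obtain ⟨f⟩ := Function.Embedding.nonempty_of_card_le hcard
      refine ⟨fun e => some (f e), ?_, ?_⟩
      · intro u v w huv hvw i huw h₁ h₂
        have h₃ : s(u, v) = s(v, w) :=
          congrArg Subtype.val (f.injective (Option.some_injective _ (h₁.trans h₂.symm)))
        rw [Sym2.eq_swap] at h₃
        exact absurd (Sym2.congr_right.1 h₃) huw
      · simp [Labeling.weakCount]
    rw [min_eq_right h]
    exact iff_of_true (key _ le_rfl) (key _ h)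

namespace MultiInstance

variable (I : MultiInstance)

open Classical in
/-- The entries of the adjacency matrix. -/
noncomputable def entry (i j : Fin I.n) : Data := Data.ofBool (decide (I.G.Adj i j))

/-- The instance on the subgraph induced by a list of vertices. -/
def restrict (l : List (Fin I.n)) (c k : ℕ) : MultiInstance where
  n := l.length
  G := I.G.comap l.get
  c := c
  k := k

/-- A No-instance. -/
def edge : MultiInstance where
  n := 2
  G := ⊤
  c := 0
  k := 0

/-- The result of the reduction. -/
noncomputable def state : ℕ × List (Fin I.n) :=
  sweep I.entry (Data.weakEntry (Data.ofNat I.c)) (List.finRange I.n) [] (min I.k (I.n ^ 2) + 1)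

/-- The kernel. -/
noncomputable def kernel : MultiInstance :=
  if I.state.1 = 0 then edge
  else I.restrict I.state.2 (min I.c (I.state.2.length ^ 2))
    (min (I.state.1 - 1) (I.state.2.length ^ 2))

theorem encode_eq : I.encode = Data.cons (Data.ofNat I.c) (Data.cons (Data.ofNat I.k)
    (mat I.entry (List.finRange I.n))) := by
  rw [encode, ← encodeMatrix_eq]
  rfl

theorem encode_restrict (l : List (Fin I.n)) (c k : ℕ) : (I.restrict l c k).encode =
    Data.cons (Data.ofNat c) (Data.cons (Data.ofNat k) (mat I.entry l)) := by
  rw [encode, ← encodeMatrix_get]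
  rfl

theorem encode_edge : edge.encode = Data.cons Data.nil (Data.cons Data.nil Data.edgeMatrix) := by
  simp [encode, edge, encodeMatrix, Data.edgeMatrix, Data.ofNat, Data.ofBool, List.ofFn_succ]

theorem kernelMulti_encode : Data.kernelMulti I.encode = I.kernel.encode := by
  have hred := reduce_mat (A := I.entry) (W := Data.weakEntry (Data.ofNat I.c)) I.k
    (List.finRange I.n)
  rw [List.length_finRange, ← state] at hred
  have hred' : Data.reduceMulti I.encode
      = Data.cons (Data.unary I.state.1) (mat I.entry I.state.2) := by
    rw [Data.reduceMulti, I.encode_eq]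
    exact hred
  by_cases h : I.state.1 = 0
  · rw [Data.kernelMulti, if_pos (by rw [hred', h]; rfl), kernel, if_pos h, encode_edge]
  · rw [Data.kernelMulti, if_neg (by rwa [hred', Data.head_cons, Data.unary_eq_nil_iff]), hred',
      budget_mat, kernel, if_neg h, encode_restrict, I.encode_eq, Data.head_cons,
      Data.capUnary_ofNat, Data.lengthBin_eq, Data.toList_unary, List.length_replicate,
      Data.tail_cons, length_flat_mat]

/-- Multi-STC is the case in which every list is the full colour set. That set is empty only for `c
= 0`; for other `c` the weak entry is a tree that does not occur in the matrix. -/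
theorem represents : Represents I.entry (Data.weakEntry (Data.ofNat I.c)) I.G
    fun _ => (Finset.univ : Finset (Fin I.c)) where
  ne_nil_iff a b := by by_cases h : I.G.Adj a b <;> simp [entry, h, Data.ofBool]
  weak_ne_nil := by rw [Data.weakEntry]; split_ifs <;> simp
  eq_weak_iff a b h := by
    have h₀ : Data.ofNat I.c = Data.nil ↔ I.c = 0 :=
      Data.ofNat_injective.eq_iff (b := 0)
    simp only [entry, h, decide_true, Data.ofBool, Data.weakEntry, h₀]
    rw [← Finset.card_eq_zero, Finset.card_fin]
    split_ifs with hc <;> simp [hc]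
  eq_iff a b a' b' h h' := by simp [entry, h, h']

theorem exists_labeling_iff_yesOn {l : List (Fin I.n)} (hl : l.Nodup) (k : ℕ) :
    (∃ L : Labeling (I.G.comap l.get) I.c, L.IsSTC ∧ L.weakCount ≤ k) ↔
      YesOn I.G (fun _ => (Finset.univ : Finset (Fin I.c))) l.toFinset (k + 1) := by
  rw [← image_get_univ, ← exists_labeling_iff (G := I.G) (G' := I.G.comap l.get) (g := l.get)
    (Ψ' := fun _ => Finset.univ) (fun _ _ => Iff.rfl) hl.injective_get (fun _ => rfl) k]
  exact exists_congr fun L => and_congr_right fun _ =>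
    ⟨fun h => ⟨fun _ _ _ => Finset.mem_univ _, h⟩, fun h => h.2⟩

theorem yes_iff : I.Yes ↔
    YesOn I.G (fun _ => (Finset.univ : Finset (Fin I.c))) Finset.univ (I.k + 1) := by
  have := exists_labeling_iff (G' := I.G) (Ψ := fun _ => (Finset.univ : Finset (Fin I.c)))
    (Ψ' := fun _ => Finset.univ) (fun _ _ => Iff.rfl) Function.injective_id (fun e => rfl) I.k
  simp only [Finset.image_id'] at this
  rw [← this]
  exact exists_congr fun L => and_congr_right fun _ =>
    ⟨fun h => ⟨fun _ _ _ => Finset.mem_univ _, h⟩, fun h => h.2⟩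

theorem not_yes_edge : ¬ edge.Yes := by
  rintro ⟨L, -, h⟩
  refine ELInstance.not_yes_edge 0 ⟨L, fun _ _ _ _ _ i => i.elim0, fun _ i => i.elim0, h⟩

theorem nodup_state : I.state.2.Nodup :=
  (sweep_spec _ _ _ [] _ (by simpa using List.nodup_finRange I.n)).1

theorem yes_iff_state : I.Yes ↔ YesOn I.G (fun _ => (Finset.univ : Finset (Fin I.c)))
    I.state.2.toFinset I.state.1 := by
  rw [state, I.represents.yesOn_sweep_iff _ _ _ (by simpa using List.nodup_finRange I.n),
    List.append_nil, List.toFinset_finRange, yes_iff, ← yesOn_min_iff]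
  simp

theorem yes_kernel_iff : I.kernel.Yes ↔ I.Yes := by
  rw [I.yes_iff_state, kernel]
  split_ifs with h
  · refine iff_of_false not_yes_edge ?_
    rintro ⟨L, -, hL⟩
    omega
  · refine (exists_labeling_min_iff (I.G.comap I.state.2.get) I.c
      (min (I.state.1 - 1) (I.state.2.length ^ 2))).trans ?_
    rw [exists_labeling_iff_yesOn _ I.nodup_state, ← List.toFinset_card_of_nodup I.nodup_state,
      yesOn_min_iff, Nat.sub_add_cancel (Nat.one_le_iff_ne_zero.2 h)]

/-- A labeling with one strong class and no weak edge can be copied into any of the available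
colours. Hence degenerate instances of Multi-STC have no colours. -/
theorem yes_of_k₁_eq_zero (hk : k₁ I.G = 0) (hc : I.c ≠ 0) : I.Yes := by
  obtain ⟨L, hL, hw⟩ := exists_good_one I.G
  have h₀ : ∀ {e i}, (L e).map (fun _ => (⟨0, Nat.pos_of_ne_zero hc⟩ : Fin I.c)) = some i →
      L e = some 0 := by
    intro e i h
    obtain ⟨j, hj, -⟩ := Option.map_eq_some_iff.1 h
    rw [hj, Subsingleton.elim j 0]
  refine ⟨fun e => (L e).map fun _ => ⟨0, Nat.pos_of_ne_zero hc⟩, ?_, ?_⟩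
  · intro u v w huv hvw i huw h₁ h₂
    exact hL u v w huv hvw 0 huw (h₀ h₁) (h₀ h₂)
  · rw [hk] at hw
    have : Labeling.weakCount (fun e => (L e).map
        fun _ => (⟨0, Nat.pos_of_ne_zero hc⟩ : Fin I.c)) = L.weakCount := by
      simp only [Labeling.weakCount, Option.map_eq_none_iff]
    rw [this, hw]
    exact Nat.zero_le _

theorem n_kernel_le : I.kernel.n ≤ 4 * k₁ I.G ∨
    (k₁ I.G = 0 ∧ I.c = 0 ∧ ¬ I.Yes ∧ I.kernel.n ≤ 2) := by
  by_cases h : I.state.1 = 0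
  · have hn : I.kernel.n = 2 := by rw [kernel, if_pos h]; rfl
    have hno : ¬ I.Yes := by
      rw [← yes_kernel_iff, kernel, if_pos h]
      exact not_yes_edge
    rcases Nat.eq_zero_or_pos (k₁ I.G) with hk | hk
    · exact Or.inr ⟨hk, by_contra fun hc => hno (I.yes_of_k₁_eq_zero hk hc), hno, hn.le⟩
    · left
      omega
  · left
    rw [kernel, if_neg h]
    obtain ⟨L₁, hL₁, hk⟩ := exists_good_card_eq_k₁ I.G
    -- Only one list occurs, so the factor is `(1 + 1) * 2 = 4`.
    have := I.represents.length_sweep_le hL₁ {Finset.univ} (fun a b _ _ => by simp)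
      (List.nodup_finRange I.n) (min I.k (I.n ^ 2) + 1)
    rw [hk, Finset.card_singleton] at this
    exact this.trans (by omega)

theorem k_kernel_le : I.kernel.k ≤ I.kernel.n ^ 2 := by
  rw [kernel]
  split_ifs
  · simp [edge]
  · exact min_le_right _ _

theorem c_kernel_le : I.kernel.c ≤ I.kernel.n ^ 2 := by
  rw [kernel]
  split_ifs
  · simp [edge]
  · exact min_le_right _ _

theorem size_encode_le : I.encode.size ≤ (4 * I.c + 1) + ((4 * I.k + 1) +
    (I.n * (I.n * (3 + 1) + 1 + 1) + 1) + 1) + 1 := by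
  rw [encode, Data.size_cons, Data.size_cons]
  gcongr
  · exact Data.size_ofNat_le _
  · exact Data.size_ofNat_le _
  · refine size_encodeMatrix_le fun i j => ?_
    have : ∀ b, (Data.ofBool b).size ≤ 3 := fun b => by cases b <;> simp [Data.ofBool]
    exact this _

/-- A bound on the number of vertices of the kernel. -/
def vertexBound (p : ℕ) : ℕ := 4 * p + 2

/-- A bound on the size and the parameter of the kernel. -/
def sizeBound (p : ℕ) : ℕ :=
  (4 * vertexBound p ^ 2 + 1) + ((4 * vertexBound p ^ 2 + 1) + (vertexBound p *
    (vertexBound p * (3 + 1) + 1 + 1) + 1) + 1) + 1 + vertexBound p ^ 2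

theorem size_kernel_le : I.kernel.encode.size + k₁ I.kernel.G ≤ sizeBound (k₁ I.G) := by
  have hn : I.kernel.n ≤ vertexBound (k₁ I.G) := by
    rw [vertexBound]
    rcases I.n_kernel_le with h | h <;> omega
  have hc := I.c_kernel_le.trans (Nat.pow_le_pow_left hn 2)
  have hk := I.k_kernel_le.trans (Nat.pow_le_pow_left hn 2)
  have hk₁ : k₁ I.kernel.G ≤ vertexBound (k₁ I.G) ^ 2 := by
    refine (k₁_le _).trans ?_
    rw [Fintype.card_fin]
    exact Nat.pow_le_pow_left hn 2
  refine (Nat.add_le_add_right I.kernel.size_encode_le _).trans ?_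
  rw [sizeBound]
  gcongr

theorem primrec_sizeBound : Primrec sizeBound := by
  have add {f g : ℕ → ℕ} (hf : Primrec f) (hg : Primrec g) : Primrec fun n => f n + g n :=
    Primrec.nat_add.comp hf hg
  have mul {f g : ℕ → ℕ} (hf : Primrec f) (hg : Primrec g) : Primrec fun n => f n * g n :=
    Primrec.nat_mul.comp hf hg
  have const (m : ℕ) : Primrec fun _ : ℕ => m := Primrec.const m
  have hv : Primrec vertexBound := add (mul (const 4) Primrec.id) (const 2)
  have hv₂ : Primrec fun p => vertexBound p ^ 2 := (mul hv hv).of_eq fun n => (sq _).symm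
  have h₁ := add (mul (const 4) hv₂) (const 1)
  exact add (add (add h₁ (add (add h₁ (add (mul hv (add (add (mul hv (const (3 + 1))) (const 1))
    (const 1))) (const 1))) (const 1))) (const 1)) hv₂

end MultiInstance

theorem isKernelization_multiKernel : IsKernelization MultiSTC MultiInstance.kernel :=
  ⟨PT.kernelMulti.polyTimeComputable MultiInstance.kernelMulti_encode,
    MultiInstance.yes_kernel_iff, MultiInstance.sizeBound,
    MultiInstance.primrec_sizeBound.to_comp, MultiInstance.size_kernel_le⟩

end STC

theorem mainTheorem5 :
    (∃ f : STC.ELInstance → STC.ELInstance, STC.IsKernelization STC.ELMultiSTC f ∧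
      ∀ I : STC.ELInstance,
        (f I).n ≤ (I.τ + 1) * (2 * STC.k₁ I.G) ∨
        (STC.k₁ I.G = 0 ∧ ¬ I.Yes ∧ (f I).n ≤ 2)) ∧
    (∃ f : STC.ELInstance → STC.ELInstance, STC.IsKernelization STC.ELMultiSTC f ∧
      ∀ I : STC.ELInstance,
        (f I).n ≤ 2 ^ (I.c + 1) * STC.k₁ I.G ∨
        (STC.k₁ I.G = 0 ∧ ¬ I.Yes ∧ (f I).n ≤ 2)) ∧
    (∃ f : STC.MultiInstance → STC.MultiInstance, STC.IsKernelization STC.MultiSTC f ∧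
      ∀ I : STC.MultiInstance,
        (f I).n ≤ 4 * STC.k₁ I.G ∨
        (STC.k₁ I.G = 0 ∧ I.c = 0 ∧ ¬ I.Yes ∧ (f I).n ≤ 2)) :=
  ⟨⟨_, STC.isKernelization_elKernel, fun I => I.n_kernel_le⟩,
    ⟨_, STC.isKernelization_elKernel, fun I => I.n_kernel_le_two_pow⟩,
    ⟨_, STC.isKernelization_multiKernel, fun I => I.n_kernel_le⟩⟩
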